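/- Let $m>0$ and let $V:\mathbb{R}^3\to\mathbb{R}$ be nonnegative (almost everywhere) with $V\in H^2(\mathbb{R}^3)$. In $L^2(\mathbb{R}^3)$ (complex-valued functions) let $h_0=-\Delta$ with domain $H^2(\mathbb{R}^3)$ and let $h=h_0+V$, where $V$ acts by multiplication; $h$ is self-adjoint with domain $H^2(\mathbb{R}^3)$. Put $\omega_0=(h_0+m^2)^{1/2}$ and $\omega=(h+m^2)^{1/2}$ (positive self-adjoint square roots; the powers $\omega_0^{\pm1/2}$, $\omega^{\pm1/2}$ are likewise those of strictly positive self-adjoint operators). Then: 1. $\omega_0^{1/2}\omega^{-1/2}$ is defined on all of $L^2(\mathbb{R}^3)$ and bounded, and $\omega_0^{1/2}\omega^{-1/2}-1$ is Hilbert–Schmidt; 2. $\omega_0^{-1/2}\omega^{1/2}$ is densely defined and extends to a bounded operator on $L^2(\mathbb{R}^3)$, and $\omega_0^{-1/2}\omega^{1/2}-1$, with this extension, is Hilbert–Schmidt; 3. $\omega_0^{-1/2}(\omega_0-\omega)\omega_0^{-1/2}$ is densely defined and extends to a bounded operator on $L^2(\mathbb{R}^3)$, and this extension is Hilbert–Schmidt.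 -/

import Mathlib

open MeasureTheory TemperedDistribution
open scoped SchwartzMap Laplacian

noncomputable section

namespace HSLemma

section Abstract

variable {H : Type*} [NormedAddCommGroup H] [InnerProductSpace ℂ H]

/-- A bounded operator on a Hilbert space is Hilbert-Schmidt if `∑ ‖T eᵢ‖² < ∞` for some
orthonormal (Hilbert) basis; the sum does not depend on the basis. -/
def IsHilbertSchmidt {H : Type} [NormedAddCommGroup H] [InnerProductSpace ℂ H]
    (T : H →L[ℂ] H) : Prop :=
  ∃ (ι : Type) (b : HilbertBasis ι ℂ H), Summable fun i => ‖T (b i)‖ ^ 2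

/-- A bounded operator, regarded as an (everywhere defined) operator with a domain. -/
def ofBounded (T : H →L[ℂ] H) : H →ₗ.[ℂ] H :=
  (T : H →ₗ[ℂ] H).toPMap ⊤

/-- The product `S T` of operators with domains, on its natural domain
`{x ∈ D(T) | T x ∈ D(S)}`. -/
def prod (S T : H →ₗ.[ℂ] H) : H →ₗ.[ℂ] H :=
  S.comp (T.domRestrict ((S.domain.comap T.toFun).map T.domain.subtype)) (by
    rintro ⟨x, hx, hxT⟩
    obtain ⟨y, hy, hyx⟩ := hx
    have h : T ⟨x, hxT⟩ = T y := congrArg T (Subtype.ext hyx.symm)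
    change T ⟨x, hxT⟩ ∈ S.domain
    rw [h]
    exact hy)

theorem mem_graph_prod_iff (S T : H →ₗ.[ℂ] H) (x z : H) :
    (x, z) ∈ (prod S T).graph ↔ ∃ y, (x, y) ∈ T.graph ∧ (y, z) ∈ S.graph := by
  constructor
  · rintro h
    obtain ⟨⟨x', hx', hxT⟩, rfl, rfl⟩ := (LinearPMap.mem_graph_iff _).1 h
    obtain ⟨y, hy, hyx⟩ := hx'
    have e : T ⟨x', hxT⟩ = T y := congrArg T (Subtype.ext hyx.symm)
    have hm : T ⟨x', hxT⟩ ∈ S.domain := by rw [e]; exact hy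
    exact ⟨T ⟨x', hxT⟩, (LinearPMap.mem_graph_iff _).2 ⟨⟨x', hxT⟩, rfl, rfl⟩,
      (LinearPMap.mem_graph_iff _).2 ⟨⟨_, hm⟩, rfl, rfl⟩⟩
  · rintro ⟨y, h1, h2⟩
    obtain ⟨x', rfl, rfl⟩ := (LinearPMap.mem_graph_iff _).1 h1
    obtain ⟨y', hy', rfl⟩ := (LinearPMap.mem_graph_iff _).1 h2
    have hm : T x' ∈ S.domain := by
      have hy'' : (y' : H) = T x' := hy'
      rw [← hy'']
      exact y'.2
    refine (LinearPMap.mem_graph_iff _).2 ⟨⟨x', ⟨x', hm, rfl⟩, x'.2⟩, rfl, ?_⟩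
    exact congrArg S (Subtype.ext hy'.symm)

/-- `R` is the bounded, everywhere defined inverse of the operator `A`:
`R x = y` if and only if `y ∈ D(A)` and `A y = x`. -/
def IsBoundedInverse (A : H →ₗ.[ℂ] H) (R : H →L[ℂ] H) : Prop :=
  ∀ x y, R x = y ↔ (y, x) ∈ A.graph

open Classical in
/-- The bounded inverse `A⁻¹` of `A` (and `0` if `A` has none). -/
def boundedInverse (A : H →ₗ.[ℂ] H) : H →L[ℂ] H :=
  if h : ∃ R : H →L[ℂ] H, IsBoundedInverse A R then h.choose else 0

theorem boundedInverse_eq {A : H →ₗ.[ℂ] H} {R : H →L[ℂ] H} (h : IsBoundedInverse A R) :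
    boundedInverse A = R := by
  have hex : ∃ R : H →L[ℂ] H, IsBoundedInverse A R := ⟨R, h⟩
  rw [boundedInverse, dif_pos hex]
  ext x
  exact (hex.choose_spec x (R x)).2 ((h x (R x)).1 rfl)

variable [CompleteSpace H]

/-- The power `A⁻ˢ = (A⁻¹)ˢ`, `s > 0`, of a strictly positive self-adjoint operator `A`:
the `s`-th power, in the continuous functional calculus, of the nonnegative bounded operator
`A⁻¹`. -/
def negPow (A : H →ₗ.[ℂ] H) (s : ℝ) : H →L[ℂ] H :=
  CFC.rpow (boundedInverse A) s

/-- The power `Aˢ = (A⁻ˢ)⁻¹`, `s > 0`, of a strictly positive self-adjoint operator `A`,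
with domain `D(Aˢ) = Ran(A⁻ˢ)`. -/
def posPow (A : H →ₗ.[ℂ] H) (s : ℝ) : H →ₗ.[ℂ] H :=
  (ofBounded (negPow A s)).inverse

/-- The operator `T` is densely defined and bounded, and its (unique) bounded extension to the
whole space is Hilbert-Schmidt. -/
def HasHilbertSchmidtExtension {H : Type} [NormedAddCommGroup H] [InnerProductSpace ℂ H]
    (T : H →ₗ.[ℂ] H) : Prop :=
  Dense (T.domain : Set H) ∧
    ∃ B : H →L[ℂ] H, (∀ x : T.domain, T x = B x) ∧ IsHilbertSchmidt B

/-- `negPow A (1/2)` squares to `A⁻¹`. -/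
theorem negPow_half_mul_self {A : H →ₗ.[ℂ] H} {R : H →L[ℂ] H} (h : IsBoundedInverse A R)
    (hR : 0 ≤ R) : negPow A (1 / 2) * negPow A (1 / 2) = R := by
  rw [negPow, boundedInverse_eq h]
  have e : CFC.rpow R (1 / 2) = CFC.sqrt R := (CFC.sqrt_eq_rpow (a := R)).symm
  rw [e, CFC.sqrt_mul_sqrt_self R hR]

theorem mem_graph_posPow_half_iff {A : H →ₗ.[ℂ] H} {R : H →L[ℂ] H} (h : IsBoundedInverse A R)
    (hR : 0 ≤ R) (x y : H) :
    (x, y) ∈ (posPow A (1 / 2)).graph ↔ negPow A (1 / 2) y = x := by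
  have hsq : ∀ z, negPow A (1 / 2) (negPow A (1 / 2) z) = R z := fun z =>
    congrArg (fun T : H →L[ℂ] H => T z) (negPow_half_mul_self h hR)
  have hker : LinearMap.ker (ofBounded (negPow A (1 / 2))).toFun = ⊥ := by
    rw [LinearMap.ker_eq_bot']
    rintro ⟨z, hz⟩ h0
    have h0' : negPow A (1 / 2) z = 0 := h0
    have hRz : R z = 0 := by rw [← hsq, h0', map_zero]
    have h1 := (LinearPMap.mem_graph_iff _).1 ((h z 0).1 hRz)
    obtain ⟨w, hw, hw'⟩ := h1
    have : w = 0 := Subtype.ext hw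
    apply Subtype.ext
    rw [this, LinearPMap.map_zero] at hw'
    exact hw'.symm
  rw [posPow, LinearPMap.inverse_graph hker, Submodule.mem_map]
  constructor
  · rintro ⟨⟨a, b⟩, hab, heq⟩
    obtain ⟨w, hw, hw'⟩ := (LinearPMap.mem_graph_iff _).1 hab
    have h1 : b = x := congrArg Prod.fst heq
    have h2 : a = y := congrArg Prod.snd heq
    rw [← h1, ← h2]
    change (w : H) = a at hw
    change negPow A (1 / 2) (w : H) = b at hw'
    rw [← hw, hw']
  · intro hxy
    exact ⟨(y, x), (LinearPMap.mem_graph_iff _).2 ⟨⟨y, trivial⟩, rfl, hxy⟩, rfl⟩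

/-- `posPow A (1/2)` is a square root of the operator `A`: the two operators
`A^{1/2} A^{1/2}` and `A` have the same domain and the same values. -/
theorem posPow_half_prod_self {A : H →ₗ.[ℂ] H} {R : H →L[ℂ] H} (h : IsBoundedInverse A R)
    (hR : 0 ≤ R) : prod (posPow A (1 / 2)) (posPow A (1 / 2)) = A := by
  apply LinearPMap.eq_of_eq_graph
  ext ⟨x, z⟩
  rw [mem_graph_prod_iff]
  simp only [mem_graph_posPow_half_iff h hR]
  rw [← h z x, ← negPow_half_mul_self h hR]
  exact ⟨fun ⟨y, h1, h2⟩ => by rw [← h1, ← h2]; rfl, fun h1 => ⟨_, h1, rfl⟩⟩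

/-- `posPow A (1/2)` is nonnegative and self-adjoint, so that it is the positive square root
of `A`. -/
theorem posPow_half_isSelfAdjoint {A : H →ₗ.[ℂ] H} {R : H →L[ℂ] H} (h : IsBoundedInverse A R)
    (hR : 0 ≤ R) : IsSelfAdjoint (posPow A (1 / 2)) ∧
      ∀ x : (posPow A (1 / 2)).domain, 0 ≤ (inner ℂ (x : H) (posPow A (1 / 2) x)).re := by
  set S := negPow A (1 / 2) with hS
  have hSnn : 0 ≤ S := by
    rw [hS, negPow]
    exact CFC.rpow_nonneg (a := boundedInverse A) (y := 1 / 2)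
  have hSpos : S.IsPositive := (ContinuousLinearMap.nonneg_iff_isPositive S).1 hSnn
  have hsym : ∀ u v, inner ℂ (S u) v = inner ℂ u (S v) := hSpos.isSymmetric
  have hg := mem_graph_posPow_half_iff h hR
  have hval : ∀ x : (posPow A (1 / 2)).domain, S (posPow A (1 / 2) x) = x := fun x =>
    (hg _ _).1 ((LinearPMap.mem_graph_iff _).2 ⟨x, rfl, rfl⟩)
  have hran : ∀ z, ∃ hz : S z ∈ (posPow A (1 / 2)).domain, posPow A (1 / 2) ⟨S z, hz⟩ = z := by
    intro z
    obtain ⟨w, hw, hw'⟩ := (LinearPMap.mem_graph_iff _).1 ((hg (S z) z).2 rfl)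
    have hwm : S z ∈ (posPow A (1 / 2)).domain := by
      have : (w : H) = S z := hw
      rw [← this]; exact w.2
    refine ⟨hwm, ?_⟩
    have : (⟨S z, hwm⟩ : (posPow A (1 / 2)).domain) = w := Subtype.ext hw.symm
    rw [this]; exact hw'
  have hdense : Dense ((posPow A (1 / 2)).domain : Set H) := by
    rw [Submodule.dense_iff_topologicalClosure_eq_top,
      Submodule.topologicalClosure_eq_top_iff, Submodule.eq_bot_iff]
    intro z hz
    have hSz : S z = 0 := by
      apply ext_inner_left ℂ
      intro v
      rw [← hsym, inner_zero_right]
      exact (Submodule.mem_orthogonal _ _).1 hz _ (hran v).choose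
    obtain ⟨hz0, hz1⟩ := hran z
    rw [← hz1, show (⟨S z, hz0⟩ : (posPow A (1 / 2)).domain) = 0 from Subtype.ext hSz,
      LinearPMap.map_zero]
  have hformal : (posPow A (1 / 2)).IsFormalAdjoint (posPow A (1 / 2)) := by
    intro x y
    conv_lhs => rw [← hval y]
    conv_rhs => rw [← hval x]
    rw [hsym]
  refine ⟨?_, ?_⟩
  · rw [LinearPMap.isSelfAdjoint_def]
    refine le_antisymm ?_ (hformal.le_adjoint hdense)
    have hadj := LinearPMap.adjoint_isFormalAdjoint hdense
    have key : ∀ y : ((posPow A (1 / 2)).adjoint).domain,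
        S ((posPow A (1 / 2)).adjoint y) = y := by
      intro y
      apply ext_inner_right ℂ
      intro z
      obtain ⟨hz0, hz1⟩ := hran z
      have := hadj y ⟨S z, hz0⟩
      rw [hz1] at this
      rw [hsym]
      exact this
    apply LinearPMap.le_of_le_graph
    rintro ⟨a, b⟩ hab
    obtain ⟨y, hy, hy'⟩ := (LinearPMap.mem_graph_iff _).1 hab
    rw [hg]
    have h1 : (y : H) = a := hy
    have h2 : (posPow A (1 / 2)).adjoint y = b := hy'
    rw [← h1, ← h2]
    exact key y
  · intro x
    have h0 : 0 ≤ (inner ℂ (S (posPow A (1 / 2) x)) (posPow A (1 / 2) x)).re :=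
      hSpos.re_inner_nonneg_left _
    rwa [hval x] at h0

end Abstract

/-- Physical space `ℝ³`. -/
abbrev Space : Type := EuclideanSpace ℝ (Fin 3)

/-- The Hilbert space `L²(ℝ³)` of complex-valued functions. -/
abbrev L2 : Type := Lp ℂ 2 (volume : Measure Space)

/-- The Sobolev space `H²(ℝ³)`, as a predicate on functions. -/
def MemH2 (f : Space → ℂ) : Prop :=
  ∃ hf : MemLp f 2 (volume : Measure Space), MemSobolev 2 2 (hf.toLp f : 𝓢'(Space, ℂ))

/-- The Sobolev space `H²(ℝ³)` as a subspace of `L²(ℝ³)`. -/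
def H2 : Submodule ℂ L2 where
  carrier := {f | MemSobolev 2 2 (f : 𝓢'(Space, ℂ))}
  zero_mem' := by
    have : ((0 : L2) : 𝓢'(Space, ℂ)) = 0 := map_zero (Lp.toTemperedDistributionCLM ℂ volume 2)
    simp [this]
  add_mem' := by
    intro f g hf hg
    have : ((f + g : L2) : 𝓢'(Space, ℂ)) = (f : 𝓢'(Space, ℂ)) + (g : 𝓢'(Space, ℂ)) :=
      map_add (Lp.toTemperedDistributionCLM ℂ volume 2) f g
    change MemSobolev 2 2 ((f + g : L2) : 𝓢'(Space, ℂ))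
    rw [this]
    exact MemSobolev.add hf hg
  smul_mem' := by
    intro c f hf
    have : ((c • f : L2) : 𝓢'(Space, ℂ)) = c • (f : 𝓢'(Space, ℂ)) :=
      map_smul (Lp.toTemperedDistributionCLM ℂ volume 2) c f
    change MemSobolev 2 2 ((c • f : L2) : 𝓢'(Space, ℂ))
    rw [this]
    exact MemSobolev.smul c hf

theorem toTemperedDistribution_injective :
    Function.Injective (fun f : L2 => (f : 𝓢'(Space, ℂ))) := by
  have := LinearMap.ker_eq_bot.1
    (Lp.ker_toTemperedDistributionCLM_eq_bot (F := ℂ) (μ := (volume : Measure Space)) (p := 2))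
  exact this

/-- The distributional Laplacian of a function in `H²(ℝ³)` is in `L²(ℝ³)`. -/
theorem exists_laplacian (f : H2) :
    ∃ g : L2, -Δ ((f : L2) : 𝓢'(Space, ℂ)) = (g : 𝓢'(Space, ℂ)) := by
  have h : MemSobolev (2 - 2) 2 (Δ ((f : L2) : 𝓢'(Space, ℂ))) := MemSobolev.laplacian f.2
  rw [sub_self, memSobolev_zero_iff] at h
  obtain ⟨g, hg⟩ := h
  exact ⟨-g, by rw [hg]; exact (map_neg (Lp.toTemperedDistributionCLM ℂ volume 2) g).symm⟩

/-- The free operator `h₀ = -Δ` (distributional Laplacian) with domain `H²(ℝ³)`. -/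
def freeOp : L2 →ₗ.[ℂ] L2 where
  domain := H2
  toFun :=
    { toFun := fun f => (exists_laplacian f).choose
      map_add' := by
        intro f g
        apply toTemperedDistribution_injective
        have e := map_add (Lp.toTemperedDistributionCLM ℂ (volume : Measure Space) 2)
          (exists_laplacian f).choose (exists_laplacian g).choose
        have e' := map_add (Lp.toTemperedDistributionCLM ℂ (volume : Measure Space) 2)
          (f : L2) (g : L2)
        simp only [Lp.toTemperedDistributionCLM_apply] at e e'
        change ((exists_laplacian (f + g)).choose : 𝓢'(Space, ℂ)) = _
        simp only [e, ← (exists_laplacian _).choose_spec]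
        rw [Submodule.coe_add, e', ← laplacianCLM_apply, ← laplacianCLM_apply, ← laplacianCLM_apply,
          map_add, neg_add]
      map_smul' := by
        intro c f
        apply toTemperedDistribution_injective
        have e := map_smul (Lp.toTemperedDistributionCLM ℂ (volume : Measure Space) 2)
          c (exists_laplacian f).choose
        have e' := map_smul (Lp.toTemperedDistributionCLM ℂ (volume : Measure Space) 2)
          c (f : L2)
        simp only [Lp.toTemperedDistributionCLM_apply] at e e'
        change ((exists_laplacian (c • f)).choose : 𝓢'(Space, ℂ)) = _
        simp only [RingHom.id_apply, e, ← (exists_laplacian _).choose_spec]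
        rw [Submodule.coe_smul, e', ← laplacianCLM_apply, ← laplacianCLM_apply, map_smul, smul_neg] }

/-- The maximal domain `{f ∈ L² | V f ∈ L²}` of multiplication by `V`. -/
def mulDomain (V : Space → ℝ) : Submodule ℂ L2 where
  carrier := {f | MemLp (fun x => (V x : ℂ) * f x) 2 (volume : Measure Space)}
  zero_mem' := by
    have h : MemLp (fun _ : Space => (0 : ℂ)) 2 (volume : Measure Space) := MemLp.zero
    refine h.ae_eq ?_
    filter_upwards [Lp.coeFn_zero ℂ 2 (volume : Measure Space)] with x hx
    rw [hx, Pi.zero_apply, mul_zero]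
  add_mem' := by
    intro f g hf hg
    refine (MemLp.add hf hg).ae_eq ?_
    filter_upwards [Lp.coeFn_add f g] with x hx
    rw [hx, Pi.add_apply, Pi.add_apply, mul_add]
  smul_mem' := by
    intro c f hf
    refine (MemLp.const_smul hf c).ae_eq ?_
    filter_upwards [Lp.coeFn_smul c f] with x hx
    rw [hx, Pi.smul_apply, Pi.smul_apply, smul_eq_mul, smul_eq_mul, mul_left_comm]

/-- The operator of multiplication by `V` in `L²(ℝ³)`, with its maximal domain. -/
def mulOp (V : Space → ℝ) : L2 →ₗ.[ℂ] L2 where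
  domain := mulDomain V
  toFun :=
    { toFun := fun f =>
        MemLp.toLp (fun x => (V x : ℂ) * (f : L2) x) (show MemLp _ 2 volume from f.2)
      map_add' := by
        intro f g
        rw [← MemLp.toLp_add]
        apply MemLp.toLp_congr
        filter_upwards [Lp.coeFn_add (f : L2) (g : L2)] with x hx
        rw [Submodule.coe_add, hx, Pi.add_apply, Pi.add_apply, mul_add]
      map_smul' := by
        intro c f
        rw [RingHom.id_apply, ← MemLp.toLp_const_smul]
        apply MemLp.toLp_congr
        filter_upwards [Lp.coeFn_smul c (f : L2)] with x hx
        rw [Submodule.coe_smul, hx, Pi.smul_apply, Pi.smul_apply, smul_eq_mul, smul_eq_mul,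
          mul_left_comm] }

/-- The Schrödinger operator `h = h₀ + V`, with domain `D(h₀) ∩ D(V)`. -/
def schrodingerOp (V : Space → ℝ) : L2 →ₗ.[ℂ] L2 := freeOp + mulOp V

/-- The free one-particle energy `ω₀ = (h₀ + m²)^{1/2}`. -/
def omega0 (m : ℝ) : L2 →ₗ.[ℂ] L2 :=
  posPow (freeOp + ofBounded (((m : ℂ) ^ 2) • ContinuousLinearMap.id ℂ L2)) (1 / 2)

/-- The one-particle energy `ω = (h + m²)^{1/2}`. -/
def omega (m : ℝ) (V : Space → ℝ) : L2 →ₗ.[ℂ] L2 :=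
  posPow (schrodingerOp V + ofBounded (((m : ℂ) ^ 2) • ContinuousLinearMap.id ℂ L2)) (1 / 2)

/-- `ω₀^{1/2} ω^{-1/2} - 1` -/
def op1 (m : ℝ) (V : Space → ℝ) : L2 →ₗ.[ℂ] L2 :=
  prod (posPow (omega0 m) (1 / 2)) (ofBounded (negPow (omega m V) (1 / 2)))
    - ofBounded (ContinuousLinearMap.id ℂ L2)

/-- `ω₀^{-1/2} ω^{1/2} - 1` -/
def op2 (m : ℝ) (V : Space → ℝ) : L2 →ₗ.[ℂ] L2 :=
  prod (ofBounded (negPow (omega0 m) (1 / 2))) (posPow (omega m V) (1 / 2))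
    - ofBounded (ContinuousLinearMap.id ℂ L2)

/-- `ω₀^{-1/2} (ω₀ - ω) ω₀^{-1/2}` -/
def op3 (m : ℝ) (V : Space → ℝ) : L2 →ₗ.[ℂ] L2 :=
  prod (ofBounded (negPow (omega0 m) (1 / 2)))
    (prod (omega0 m - omega m V) (ofBounded (negPow (omega0 m) (1 / 2))))

end HSLemma

end

/-! Everything reduces to the bounded inverses `R₀` of `h₀ + m²` and `R` of `h + m²`. In dimension
three `H²` embeds in `L^∞`, so `V` is a bounded operator and `R₀ - R = R₀ V R = R V R₀`. Put `K₀ =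
R₀^{1/4} = ω₀^{-1/2}` and `K = R^{1/4} = ω^{-1/2}`. It suffices to find Hilbert-Schmidt `B₁`, `B₂`
with `K = K₀(1 + B₁)` and `K₀ = K(1 + B₂)`. Then `ω₀^{1/2} ω^{-1/2} = 1 + B₁`; taking adjoints,
`ω₀^{-1/2} ω^{1/2}` extends to `1 + B₂*`; and `ω₀^{-1/2} ω ω₀^{-1/2}` is `(1 + B₂*)(1 + B₂)` on a
dense domain, so the third operator extends to `-(B₂ + B₂* + B₂* B₂)`.

The factorization (`exists_isHilbertSchmidt_nnrpow_eq`) comes from `a^{1/4} = c ∫ t^{1/4} (t⁻¹ - (t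
+ a)⁻¹) dt` over `t > 0`. If `a - b = a W b`, the second resolvent identity lets `a^{1/4}` be pulled
out of the difference of the integrals on the left, leaving `t^{1/4} · a^{3/4}(t + a)⁻¹ · W b (t +
b)⁻¹`. The middle factor is `O(t^{-1/4})` near `0` and `O(t⁻¹)` at infinity, so a Hilbert-Schmidt
bound `O(t^{-7/8})` on the last one makes the integral converge.

That bound rests on `V R₀ (t + R₀)⁻¹ = V (1 + t(h₀ + m²))⁻¹`, a product `V(x) g(-i∇)` whose
Hilbert-Schmidt norm is at most `‖V‖₂ ‖g‖₂` (`hsBound_mulL_fourierMul`). Any decay `t^{-s}` with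
`3/4 < s < 1` would serve: `s > 3/4` makes the momentum integral finite in dimension three, and `s <
1` gives integrability at `t = 0`. -/

noncomputable section

namespace HSLemma


/-! ### Hilbert-Schmidt bounds: ideal property, adjoints, integrals -/

section HilbertSchmidt

variable {H : Type} [NormedAddCommGroup H] [InnerProductSpace ℂ H]

/-- The Hilbert-Schmidt norm of `T`, computed on the family `e`, is at most `|c|`. -/
def HSBound {ι : Type} (e : ι → H) (T : H →L[ℂ] H) (c : ℝ) : Prop :=
  ∀ s : Finset ι, ∑ i ∈ s, ‖T (e i)‖ ^ 2 ≤ c ^ 2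

theorem HSBound.summable {ι : Type} {e : ι → H} {T : H →L[ℂ] H} {c : ℝ} (h : HSBound e T c) :
    Summable fun i => ‖T (e i)‖ ^ 2 :=
  summable_of_sum_le (fun _ => sq_nonneg _) h

theorem HSBound.isHilbertSchmidt {ι : Type} {e : HilbertBasis ι ℂ H} {T : H →L[ℂ] H} {c : ℝ}
    (h : HSBound e T c) : IsHilbertSchmidt T :=
  ⟨ι, e, h.summable⟩

theorem HSBound.mono {ι : Type} {e : ι → H} {T : H →L[ℂ] H} {c d : ℝ} (h : HSBound e T c)
    (hc : 0 ≤ c) (hcd : c ≤ d) : HSBound e T d := fun s =>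
  (h s).trans (pow_le_pow_left₀ hc hcd 2)

theorem HSBound.comp_left {ι : Type} {e : ι → H} {T : H →L[ℂ] H} {c : ℝ} (h : HSBound e T c)
    (A : H →L[ℂ] H) : HSBound e (A * T) (‖A‖ * c) := fun s => by
  calc ∑ i ∈ s, ‖(A * T) (e i)‖ ^ 2 ≤ ∑ i ∈ s, ‖A‖ ^ 2 * ‖T (e i)‖ ^ 2 := by
        refine Finset.sum_le_sum fun i _ => ?_
        rw [← mul_pow]
        exact pow_le_pow_left₀ (norm_nonneg _) (A.le_opNorm _) 2
    _ = ‖A‖ ^ 2 * ∑ i ∈ s, ‖T (e i)‖ ^ 2 := by rw [Finset.mul_sum]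
    _ ≤ ‖A‖ ^ 2 * c ^ 2 := by gcongr; exact h s
    _ = (‖A‖ * c) ^ 2 := by ring

theorem IsHilbertSchmidt.neg {T : H →L[ℂ] H} (hT : IsHilbertSchmidt T) :
    IsHilbertSchmidt (-T) := by
  obtain ⟨ι, b, h⟩ := hT
  exact ⟨ι, b, by simpa using h⟩

theorem IsHilbertSchmidt.comp_left {T : H →L[ℂ] H} (hT : IsHilbertSchmidt T) (A : H →L[ℂ] H) :
    IsHilbertSchmidt (A * T) := by
  obtain ⟨ι, b, h⟩ := hT
  refine ⟨ι, b, (h.mul_left (‖A‖ ^ 2)).of_nonneg_of_le (fun _ => sq_nonneg _) fun i => ?_⟩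
  rw [← mul_pow]
  exact pow_le_pow_left₀ (norm_nonneg _) (A.le_opNorm _) 2

variable [CompleteSpace H]

/-- Expand `‖T* fⱼ‖²` by Parseval in `e`, exchange the sums, and apply Bessel in `f` to each `T eᵢ`.
Since `f` is arbitrary, this also changes the basis. -/
theorem HSBound.adjoint {ι κ : Type} {e : HilbertBasis ι ℂ H} {T : H →L[ℂ] H} {c : ℝ}
    (h : HSBound e T c) (f : HilbertBasis κ ℂ H) : HSBound f (star T) c := fun s => by
  have hpars : ∀ y : H, HasSum (fun i => ‖inner ℂ (e i) y‖ ^ 2) (‖y‖ ^ 2) := fun y => by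
    refine Complex.hasSum_ofReal.1 ?_
    have := e.hasSum_inner_mul_inner y y
    rw [inner_self_eq_norm_sq_to_K] at this
    convert this using 1
    · rfl
    · funext i
      rw [← inner_conj_symm y (e i), ← Complex.normSq_eq_conj_mul_self,
        Complex.normSq_eq_norm_sq]
    · exact Complex.ofReal_pow _ _
  have h1 : HasSum (fun i => ∑ j ∈ s, ‖inner ℂ (e i) (star T (f j))‖ ^ 2)
      (∑ j ∈ s, ‖star T (f j)‖ ^ 2) := hasSum_sum fun j _ => hpars _
  rw [← h1.tsum_eq]
  refine (h1.summable.tsum_le_tsum (fun i => ?_) h.summable).trans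
    (h.summable.tsum_le_of_sum_le h)
  have : ∀ j, ‖inner ℂ (e i) (star T (f j))‖ = ‖inner ℂ (f j) (T (e i))‖ := fun j => by
    rw [ContinuousLinearMap.star_eq_adjoint, ContinuousLinearMap.adjoint_inner_right,
      norm_inner_symm]
  simp only [this]
  exact f.orthonormal.sum_inner_products_le _

theorem HSBound.comp_right {ι : Type} {e : HilbertBasis ι ℂ H} {T : H →L[ℂ] H} {c : ℝ}
    (h : HSBound e T c) (A : H →L[ℂ] H) : HSBound e (T * A) (‖A‖ * c) := by
  have := ((h.adjoint e).comp_left (star A)).adjoint e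
  rwa [star_mul, star_star, star_star, norm_star] at this

/-- Minkowski's inequality: evaluation on finitely many `eᵢ` is a continuous linear map `Φ` into an
`ℓ²` sum of copies of `H`, so the norm of an integral is at most the integral of the norms. Bochner
integrability is needed only in operator norm. -/
theorem HSBound.integral {α ι : Type} [MeasurableSpace α] {μ : Measure α} {e : ι → H}
    {G : α → H →L[ℂ] H} {ψ : α → ℝ} (hG : Integrable G μ) (hψ : Integrable ψ μ)
    (hψ0 : ∀ᵐ t ∂μ, 0 ≤ ψ t) (h : ∀ᵐ t ∂μ, HSBound e (G t) (ψ t)) :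
    HSBound e (∫ t, G t ∂μ) (∫ t, ψ t ∂μ) := fun s => by
  let Φ : (H →L[ℂ] H) →L[ℂ] PiLp 2 (fun _ : s => H) :=
    (PiLp.continuousLinearEquiv 2 ℂ (fun _ : s => H)).symm.toContinuousLinearMap ∘L
      ContinuousLinearMap.pi fun i => ContinuousLinearMap.apply ℂ H (e i)
  have hΦ : ∀ T, ‖Φ T‖ ^ 2 = ∑ i ∈ s, ‖T (e i)‖ ^ 2 := fun T => by
    rw [PiLp.norm_sq_eq_of_L2]
    exact Finset.sum_coe_sort s fun i => ‖T (e i)‖ ^ 2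
  rw [← hΦ, ← Φ.integral_comp_comm hG]
  refine pow_le_pow_left₀ (norm_nonneg _) ?_ 2
  refine norm_integral_le_of_norm_le hψ ?_
  filter_upwards [hψ0, h] with t h0 ht
  refine (sq_le_sq₀ (norm_nonneg _) h0).1 ?_
  rw [hΦ]
  exact ht s

/-- Basis independence, by passing to the adjoint twice. -/
theorem IsHilbertSchmidt.exists_hsBound {T : H →L[ℂ] H} (hT : IsHilbertSchmidt T)
    {κ : Type} (f : HilbertBasis κ ℂ H) : ∃ c, HSBound f T c := by
  obtain ⟨ι, b, h⟩ := hT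
  have hb : HSBound b T (Real.sqrt (∑' i, ‖T (b i)‖ ^ 2)) := fun s => by
    rw [Real.sq_sqrt (tsum_nonneg fun _ => sq_nonneg _)]
    exact h.sum_le_tsum s fun _ _ => sq_nonneg _
  have := (hb.adjoint f).adjoint f
  rw [star_star] at this
  exact ⟨_, this⟩

theorem IsHilbertSchmidt.add {S T : H →L[ℂ] H} (hS : IsHilbertSchmidt S)
    (hT : IsHilbertSchmidt T) : IsHilbertSchmidt (S + T) := by
  obtain ⟨ι, b, h⟩ := hS
  obtain ⟨c, hc⟩ := hT.exists_hsBound b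
  refine ⟨ι, b, ((h.add hc.summable).mul_left 2).of_nonneg_of_le (fun _ => sq_nonneg _)
    fun i => ?_⟩
  have := norm_add_le (S (b i)) (T (b i))
  calc ‖S (b i) + T (b i)‖ ^ 2 ≤ (‖S (b i)‖ + ‖T (b i)‖) ^ 2 :=
        pow_le_pow_left₀ (norm_nonneg _) this 2
    _ ≤ _ := add_sq_le

theorem IsHilbertSchmidt.star {T : H →L[ℂ] H} (hT : IsHilbertSchmidt T) :
    IsHilbertSchmidt (star T) := by
  obtain ⟨ι, b, -⟩ := id hT
  obtain ⟨c, hc⟩ := hT.exists_hsBound b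
  exact (hc.adjoint b).isHilbertSchmidt

end HilbertSchmidt


/-! ### Resolvent estimates and the integral formula for fractional powers -/

section Resolvent

open scoped NNReal

variable {A : Type*} [CStarAlgebra A] [PartialOrder A] [StarOrderedRing A]

/-- The resolvent `(t + a)⁻¹`. -/
def resolv (a : A) (t : ℝ) : A := cfc (fun x : ℝ => (t + x)⁻¹) a

theorem spectrum_nonneg {a : A} (ha : 0 ≤ a) {x : ℝ} (hx : x ∈ spectrum ℝ a) : 0 ≤ x :=
  spectrum_nonneg_of_nonneg ha hx

theorem continuousOn_resolv_fun {a : A} (ha : 0 ≤ a) {t : ℝ} (ht : 0 < t) :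
    ContinuousOn (fun x : ℝ => (t + x)⁻¹) (spectrum ℝ a) :=
  ContinuousOn.inv₀ (by fun_prop) fun x hx => by
    have := spectrum_nonneg ha hx
    positivity

theorem mul_resolv {a : A} (ha : 0 ≤ a) {t : ℝ} (ht : 0 < t) :
    (t • (1 : A) + a) * resolv a t = 1 := by
  have hc := continuousOn_resolv_fun ha ht
  have h1 : t • (1 : A) + a = cfc (fun x : ℝ => t + x) a := by
    rw [cfc_const_add t (fun x => x) a, cfc_id' ℝ a, Algebra.algebraMap_eq_smul_one]
  rw [h1, resolv, ← cfc_mul (fun x : ℝ => t + x) _ a (by fun_prop) hc, ← cfc_one ℝ a]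
  refine cfc_congr fun x hx => ?_
  have := spectrum_nonneg ha hx
  have : t + x ≠ 0 := by positivity
  simp [this]

theorem resolv_mul_self_comm {a : A} (ha : 0 ≤ a) (t : ℝ) :
    resolv a t * a = a * resolv a t := by
  have := (cfc_commute_cfc (fun x : ℝ => (t + x)⁻¹) id a).eq
  rwa [cfc_id ℝ a] at this

theorem resolv_mul {a : A} (ha : 0 ≤ a) {t : ℝ} (ht : 0 < t) :
    resolv a t * (t • (1 : A) + a) = 1 := by
  have hc : Commute (resolv a t) (t • (1 : A) + a) :=
    ((Commute.one_right _).smul_right t).add_right (resolv_mul_self_comm ha t)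
  rw [hc.eq, mul_resolv ha ht]

theorem mul_resolv_eq {a : A} (ha : 0 ≤ a) {t : ℝ} (ht : 0 < t) :
    a * resolv a t = 1 - t • resolv a t := by
  have := mul_resolv ha ht
  rw [add_mul, smul_mul_assoc, one_mul] at this
  rw [← this, add_sub_cancel_left]

theorem mul_resolv_eq_of_mul_eq {a b : A} (ha : 0 ≤ a) {t : ℝ} (ht : 0 < t)
    (h : (t • (1 : A) + a) * b = a) : a * resolv a t = b := by
  rw [← resolv_mul_self_comm ha]
  nth_rewrite 2 [← h]
  rw [← mul_assoc, resolv_mul ha ht, one_mul]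

theorem resolv_eq_ringInverse {a : A} (ha : 0 ≤ a) {t : ℝ} (ht : 0 < t) :
    resolv a t = Ring.inverse (t • (1 : A) + a) := by
  let u : Aˣ := ⟨_, _, mul_resolv ha ht, resolv_mul ha ht⟩
  exact (Ring.inverse_unit u).symm

/-- Inversion is continuous at units; this supplies measurability of the integrands in `t`. -/
theorem continuousOn_resolv {a : A} (ha : 0 ≤ a) :
    ContinuousOn (resolv a) (Set.Ioi 0) := by
  refine ContinuousOn.congr (f := fun t => Ring.inverse (t • (1 : A) + a)) ?_
    fun t ht => resolv_eq_ringInverse ha ht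
  intro t ht
  let u : Aˣ := ⟨_, _, mul_resolv ha ht, resolv_mul ha ht⟩
  have h1 : ContinuousAt Ring.inverse (t • (1 : A) + a) := NormedRing.inverse_continuousAt u
  exact (ContinuousAt.comp (f := fun t : ℝ => t • (1 : A) + a) h1
    (by fun_prop)).continuousWithinAt

theorem norm_smul_resolv_le {a : A} (ha : 0 ≤ a) {t : ℝ} (ht : 0 < t) :
    ‖t • resolv a t‖ ≤ 1 := by
  rw [resolv, ← cfc_smul t _ a (continuousOn_resolv_fun ha ht)]
  refine norm_cfc_le zero_le_one fun x hx => ?_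
  have := spectrum_nonneg ha hx
  rw [smul_eq_mul, Real.norm_of_nonneg (by positivity), ← div_eq_mul_inv]
  exact div_le_one_of_le₀ (by linarith) (by positivity)

theorem resolv_sub_resolv {a b : A} (ha : 0 ≤ a) (hb : 0 ≤ b) {t : ℝ} (ht : 0 < t) :
    resolv a t - resolv b t = resolv a t * (b - a) * resolv b t := by
  have h : b - a = (t • (1 : A) + b) - (t • (1 : A) + a) := by abel
  rw [h, mul_sub, sub_mul, resolv_mul ha ht, mul_assoc, mul_resolv hb ht, mul_one, one_mul]

theorem nnrpow_eq_cfc_real {a : A} (ha : 0 ≤ a) {p : ℝ≥0} (hp : 0 < p) :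
    a ^ p = cfc (fun x : ℝ => x ^ (p : ℝ)) a := by
  rw [CFC.nnrpow_eq_rpow hp, CFC.rpow_eq_cfc_real ha]

/-- On the spectrum, `x^p / (t + x) ≤ (t + x)^{p-1} ≤ t^{p-1}`. Used for small `t`; the next lemma
decays faster at infinity. -/
theorem norm_nnrpow_mul_resolv_le {a : A} (ha : 0 ≤ a) {p : ℝ≥0} (hp : 0 < p) (hp1 : p < 1)
    {t : ℝ} (ht : 0 < t) : ‖a ^ p * resolv a t‖ ≤ t ^ ((p : ℝ) - 1) := by
  have hp' : (0 : ℝ) ≤ p := p.2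
  rw [nnrpow_eq_cfc_real ha hp, resolv,
    ← cfc_mul _ _ a (Real.continuous_rpow_const hp').continuousOn (continuousOn_resolv_fun ha ht)]
  refine norm_cfc_le (by positivity) fun x hx => ?_
  have hx := spectrum_nonneg ha hx
  have hp1' : (p : ℝ) ≤ 1 := by exact_mod_cast hp1.le
  rw [Real.norm_of_nonneg (by positivity), ← div_eq_mul_inv, div_le_iff₀ (by positivity)]
  calc x ^ (p : ℝ) ≤ (t + x) ^ (p : ℝ) := Real.rpow_le_rpow hx (by linarith) hp'
    _ = (t + x) ^ ((p : ℝ) - 1) * (t + x) := by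
      rw [Real.rpow_sub_one (by positivity), div_mul_cancel₀ _ (by positivity)]
    _ ≤ t ^ ((p : ℝ) - 1) * (t + x) := by
      gcongr ?_ * _
      exact Real.rpow_le_rpow_of_nonpos ht (by linarith) (by linarith)

theorem norm_nnrpow_mul_resolv_le' {a : A} (ha : 0 ≤ a) (p : ℝ≥0)
    {t : ℝ} (ht : 0 < t) : ‖a ^ p * resolv a t‖ ≤ ‖a ^ p‖ * t⁻¹ := by
  refine (norm_mul_le _ _).trans ?_
  gcongr
  have := norm_smul_resolv_le ha ht
  rwa [norm_smul, Real.norm_of_nonneg ht.le, mul_comm, ← le_div_iff₀ ht, one_div] at this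

theorem cfc_rpowIntegrand {a : A} (ha : 0 ≤ a) {p t : ℝ} (ht : 0 < t) :
    cfc (Real.rpowIntegrand₀₁ p t) a = t ^ p • (t⁻¹ • (1 : A) - resolv a t) := by
  have hc := continuousOn_resolv_fun ha ht
  change cfc (fun x => t ^ p * (t⁻¹ - (t + x)⁻¹)) a = _
  rw [cfc_const_mul _ _ a (by fun_prop), cfc_sub (fun _ => t⁻¹) _ a (by fun_prop) hc,
    cfc_const _ a, Algebra.algebraMap_eq_smul_one, resolv]

/-- The scalar formula for `x^p` passes through the functional calculus. The integrand increases
with `x`, so its value at `x = ‖a‖` is an integrable majorant on the whole spectrum. -/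
theorem integrableOn_cfc_rpowIntegrand_and_nnrpow_eq {a : A} (ha : 0 ≤ a) {p : ℝ≥0}
    (hp : (p : ℝ) ∈ Set.Ioo 0 1) :
    IntegrableOn (fun t => cfc (Real.rpowIntegrand₀₁ p t) a) (Set.Ioi 0) ∧
    a ^ p = (∫ t in Set.Ioi 0, Real.rpowIntegrand₀₁ p t 1)⁻¹ •
      ∫ t in Set.Ioi 0, cfc (Real.rpowIntegrand₀₁ p t) a := by
  nontriviality A
  have hf : ContinuousOn (Function.uncurry (Real.rpowIntegrand₀₁ p))
      (Set.Ioi (0 : ℝ) ×ˢ spectrum ℝ a) :=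
    Real.continuousOn_rpowIntegrand₀₁_uncurry hp _ fun x hx => spectrum_nonneg ha hx
  have hbound : ∀ᵐ t ∂volume.restrict (Set.Ioi (0 : ℝ)), ∀ z ∈ spectrum ℝ a,
      ‖Real.rpowIntegrand₀₁ p t z‖ ≤ Real.rpowIntegrand₀₁ p t ‖a‖ := by
    filter_upwards [ae_restrict_mem measurableSet_Ioi] with t ht z hz
    have hz' := spectrum_nonneg ha hz
    rw [Real.norm_of_nonneg (Real.rpowIntegrand₀₁_nonneg hp.1 (le_of_lt ht) hz')]
    refine Real.rpowIntegrand₀₁_monotoneOn hp (le_of_lt ht) hz' (norm_nonneg a) ?_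
    exact (le_abs_self z).trans (spectrum.norm_le_norm_of_mem hz)
  have hfin := (Real.integrableOn_rpowIntegrand₀₁_Ioi hp (norm_nonneg a)).2
  refine ⟨integrableOn_cfc measurableSet_Ioi _ _ a hf hbound hfin, ?_⟩
  rw [← cfc_setIntegral measurableSet_Ioi _ _ a hf hbound hfin,
    nnrpow_eq_cfc_real ha (by exact_mod_cast hp.1)]
  have hp' : (0 : ℝ) < p := hp.1
  set c := ∫ t in Set.Ioi 0, Real.rpowIntegrand₀₁ p t 1
  have hc : c ≠ 0 := (Real.integral_rpowIntegrand₀₁_one_pos hp).ne'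
  rw [eq_inv_smul_iff₀ hc, ← cfc_smul c _ a (Real.continuous_rpow_const hp'.le).continuousOn]
  refine cfc_congr fun x hx => ?_
  simp only [smul_eq_mul]
  rw [Real.integral_rpowIntegrand₀₁_eq_rpow_mul_const hp (spectrum_nonneg ha hx), mul_comm]

end Resolvent


/-! ### Factorization of the difference of fourth roots -/

section PowerDifference

open scoped NNReal

variable {H : Type} [NormedAddCommGroup H] [InnerProductSpace ℂ H] [CompleteSpace H]

theorem integrableOn_Ioi_of_Ioc_of_Ioi {E : Type*} [NormedAddCommGroup E] {f : ℝ → E}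
    (hf : ContinuousOn f (Set.Ioi 0)) {K L r s : ℝ} (hr : -1 < r) (hs : s < -1)
    (h0 : ∀ t, 0 < t → t ≤ 1 → ‖f t‖ ≤ K * t ^ r) (h1 : ∀ t, 1 < t → ‖f t‖ ≤ L * t ^ s) :
    IntegrableOn f (Set.Ioi 0) := by
  have hm := hf.aestronglyMeasurable measurableSet_Ioi (μ := volume)
  rw [← Set.Ioc_union_Ioi_eq_Ioi zero_le_one]
  refine IntegrableOn.union ?_ ?_
  · have hi : IntegrableOn (fun t : ℝ => K * t ^ r) (Set.Ioc 0 1) :=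
      Integrable.const_mul ((intervalIntegrable_iff_integrableOn_Ioc_of_le zero_le_one).1
        (intervalIntegral.intervalIntegrable_rpow' hr)) K
    refine Integrable.mono' hi (hm.mono_set Set.Ioc_subset_Ioi_self) ?_
    filter_upwards [ae_restrict_mem measurableSet_Ioc] with t ht using h0 t ht.1 ht.2
  · have hi : IntegrableOn (fun t : ℝ => L * t ^ s) (Set.Ioi 1) :=
      Integrable.const_mul (integrableOn_Ioi_rpow_of_lt hs zero_lt_one) L
    refine Integrable.mono' hi (hm.mono_set (Set.Ioi_subset_Ioi zero_le_one)) ?_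
    filter_upwards [ae_restrict_mem measurableSet_Ioi] with t ht using h1 t ht

theorem norm_mul_resolv_le {a : H →L[ℂ] H} (ha : 0 ≤ a) {t : ℝ} (ht : 0 < t) :
    ‖a * resolv a t‖ ≤ 2 ∧ ‖a * resolv a t‖ ≤ ‖a‖ * t⁻¹ := by
  have h := norm_smul_resolv_le ha ht
  constructor
  · rw [mul_resolv_eq ha ht]
    refine (norm_sub_le _ _).trans ?_
    have : ‖(1 : H →L[ℂ] H)‖ ≤ 1 := ContinuousLinearMap.norm_id_le
    linarith
  · refine (norm_mul_le _ _).trans ?_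
    gcongr
    rwa [norm_smul, Real.norm_of_nonneg ht.le, mul_comm, ← le_div_iff₀ ht, one_div] at h

set_option maxHeartbeats 1000000 in
/-- If `a - b = a W b` (so that formally `a⁻¹ + W = b⁻¹`) and the Hilbert-Schmidt norm of
`W b (t + b)⁻¹` is `O(t^{-7/8})`, then `b^{1/4}` is `a^{1/4}` times a Hilbert-Schmidt perturbation
of the identity. -/
theorem exists_isHilbertSchmidt_nnrpow_eq {a b W : H →L[ℂ] H} (ha : 0 ≤ a) (hb : 0 ≤ b)
    (hab : a - b = a * W * b) {ι : Type} (e : HilbertBasis ι ℂ H) {C : ℝ} (hC : 0 ≤ C)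
    (h : ∀ t : ℝ, 0 < t → HSBound e (W * (b * resolv b t)) (C * t ^ (-(7 / 8) : ℝ))) :
    ∃ B : H →L[ℂ] H, IsHilbertSchmidt B ∧
      b ^ (1 / 4 : ℝ≥0) = a ^ (1 / 4 : ℝ≥0) + a ^ (1 / 4 : ℝ≥0) * B := by
  have hpr : ((1 / 4 : ℝ≥0) : ℝ) = 1 / 4 := by norm_num
  have hp : ((1 / 4 : ℝ≥0) : ℝ) ∈ Set.Ioo 0 1 := by rw [hpr]; norm_num
  have hq : (0 : ℝ≥0) < 3 / 4 := by norm_num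
  have hq1 : (3 / 4 : ℝ≥0) < 1 := by
    rw [← NNReal.coe_lt_coe]; norm_num
  have hqr : ((3 / 4 : ℝ≥0) : ℝ) - 1 = -(1 / 4) := by norm_num
  set M := ‖a ^ (3 / 4 : ℝ≥0)‖ with hM
  have hM0 : 0 ≤ M := norm_nonneg _
  let L : ℝ → H →L[ℂ] H := fun t => a ^ (3 / 4 : ℝ≥0) * resolv a t
  have hL1 : ∀ t, 0 < t → ‖L t‖ ≤ t ^ (-(1 / 4) : ℝ) := fun t ht => by
    rw [← hqr]; exact norm_nnrpow_mul_resolv_le ha hq hq1 ht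
  have hL2 : ∀ t, 0 < t → ‖L t‖ ≤ M * t ^ (-1 : ℝ) := fun t ht => by
    rw [Real.rpow_neg_one]; exact norm_nnrpow_mul_resolv_le' ha _ ht
  have hcL : ContinuousOn L (Set.Ioi 0) := continuousOn_const.mul (continuousOn_resolv ha)
  have hrp : ∀ r : ℝ, ContinuousOn (fun t : ℝ => t ^ r) (Set.Ioi 0) := fun r =>
    ContinuousOn.rpow_const continuousOn_id fun t ht => Or.inl (ne_of_gt ht)
  let T : ℝ → H →L[ℂ] H := fun t => W * (b * resolv b t)
  have hcT : ContinuousOn T (Set.Ioi 0) :=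
    continuousOn_const.mul (continuousOn_const.mul (continuousOn_resolv hb))
  let G : ℝ → H →L[ℂ] H := fun t => t ^ (1 / 4 : ℝ) • (L t * T t)
  have hcG : ContinuousOn G (Set.Ioi 0) := (hrp _).smul (hcL.mul hcT)
  have hnG : ∀ t, 0 < t → ‖G t‖ ≤ t ^ (1 / 4 : ℝ) * (‖L t‖ * ‖T t‖) := fun t ht => by
    rw [norm_smul, Real.norm_of_nonneg (by positivity)]
    gcongr
    exact norm_mul_le _ _
  -- Operator-norm integrability, so that the Bochner integral makes sense: the exponents are `1/4 -
  -- 1/4 = 0` near zero and `1/4 - 1 - 1 = -7/4` at infinity.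
  have hGi : IntegrableOn G (Set.Ioi 0) := by
    refine integrableOn_Ioi_of_Ioc_of_Ioi (K := ‖W‖ * 2) (L := M * (‖W‖ * ‖b‖)) (r := 0)
      (s := -(7 / 4)) hcG (by norm_num) (by norm_num) (fun t ht _ => ?_) (fun t ht => ?_)
    · refine (hnG t ht).trans ?_
      calc t ^ (1 / 4 : ℝ) * (‖L t‖ * ‖T t‖)
          ≤ t ^ (1 / 4 : ℝ) * (t ^ (-(1 / 4) : ℝ) * (‖W‖ * 2)) := by
            gcongr
            · exact hL1 t ht
            · refine (norm_mul_le _ _).trans ?_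
              gcongr
              exact (norm_mul_resolv_le hb ht).1
        _ = ‖W‖ * 2 * t ^ (0 : ℝ) := by
            rw [← mul_assoc, ← Real.rpow_add ht]; norm_num
    · have ht : 0 < t := by linarith
      refine (hnG t ht).trans ?_
      calc t ^ (1 / 4 : ℝ) * (‖L t‖ * ‖T t‖)
          ≤ t ^ (1 / 4 : ℝ) * ((M * t ^ (-1 : ℝ)) * (‖W‖ * (‖b‖ * t ^ (-1 : ℝ)))) := by
            gcongr
            · exact hL2 t ht
            · refine (norm_mul_le _ _).trans ?_
              gcongr
              rw [Real.rpow_neg_one]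
              exact (norm_mul_resolv_le hb ht).2
        _ = M * (‖W‖ * ‖b‖) * (t ^ (1 / 4 : ℝ) * t ^ (-1 : ℝ) * t ^ (-1 : ℝ)) := by ring
        _ = M * (‖W‖ * ‖b‖) * t ^ (-(7 / 4) : ℝ) := by
            rw [← Real.rpow_add ht, ← Real.rpow_add ht]; norm_num
  -- The Hilbert-Schmidt majorant: exponents `1/4 - 1/4 - 7/8 = -7/8` near zero and `1/4 - 1 - 7/8 =
  -- -13/8` at infinity.
  let ψ : ℝ → ℝ := fun t => t ^ (1 / 4 : ℝ) * (‖L t‖ * (C * t ^ (-(7 / 8) : ℝ)))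
  have hψ0 : ∀ t, 0 < t → 0 ≤ ψ t := fun t ht => by positivity
  have hψi : IntegrableOn ψ (Set.Ioi 0) := by
    refine integrableOn_Ioi_of_Ioc_of_Ioi (K := C) (L := M * C) (r := -(7 / 8))
      (s := -(13 / 8)) ((hrp _).mul (hcL.norm.mul (continuousOn_const.mul (hrp _))))
      (by norm_num) (by norm_num) (fun t ht _ => ?_) (fun t ht => ?_)
    · rw [Real.norm_of_nonneg (hψ0 t ht)]
      calc ψ t ≤ t ^ (1 / 4 : ℝ) * (t ^ (-(1 / 4) : ℝ) * (C * t ^ (-(7 / 8) : ℝ))) := by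
            simp only [ψ]
            gcongr
            exact hL1 t ht
        _ = C * t ^ (-(7 / 8) : ℝ) := by
            rw [← mul_assoc, ← Real.rpow_add ht]; norm_num
    · have ht : 0 < t := by linarith
      rw [Real.norm_of_nonneg (hψ0 t ht)]
      calc ψ t ≤ t ^ (1 / 4 : ℝ) * ((M * t ^ (-1 : ℝ)) * (C * t ^ (-(7 / 8) : ℝ))) := by
            simp only [ψ]
            gcongr
            exact hL2 t ht
        _ = M * C * (t ^ (1 / 4 : ℝ) * t ^ (-1 : ℝ) * t ^ (-(7 / 8) : ℝ)) := by ring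
        _ = M * C * t ^ (-(13 / 8) : ℝ) := by
            rw [← Real.rpow_add ht, ← Real.rpow_add ht]; norm_num
  have hGb : ∀ t, 0 < t → HSBound e (G t) (ψ t) := fun t ht => by
    have h1 := ((h t ht).comp_left (L t)).comp_left (t ^ (1 / 4 : ℝ) • (1 : H →L[ℂ] H))
    rw [smul_mul_assoc, one_mul] at h1
    have hn : ‖t ^ (1 / 4 : ℝ) • (1 : H →L[ℂ] H)‖ ≤ t ^ (1 / 4 : ℝ) := by
      rw [norm_smul, Real.norm_of_nonneg (by positivity)]
      exact mul_le_of_le_one_right (by positivity) ContinuousLinearMap.norm_id_le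
    exact h1.mono (by positivity) (mul_le_mul_of_nonneg_right hn (by positivity))
  have hGint : HSBound e (∫ t in Set.Ioi 0, G t) (∫ t in Set.Ioi 0, ψ t) :=
    HSBound.integral hGi hψi (ae_restrict_of_forall_mem measurableSet_Ioi hψ0)
      (ae_restrict_of_forall_mem measurableSet_Ioi hGb)
  obtain ⟨hia, hea⟩ := integrableOn_cfc_rpowIntegrand_and_nnrpow_eq ha hp
  obtain ⟨hib, heb⟩ := integrableOn_cfc_rpowIntegrand_and_nnrpow_eq hb hp
  set c := (∫ t in Set.Ioi 0, Real.rpowIntegrand₀₁ ((1 / 4 : ℝ≥0) : ℝ) t 1)⁻¹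
  refine ⟨-((c • (1 : H →L[ℂ] H)) * ∫ t in Set.Ioi 0, G t),
    (hGint.comp_left _).isHilbertSchmidt.neg, ?_⟩
  rw [← sub_eq_iff_eq_add', smul_mul_assoc, one_mul, mul_neg, mul_smul_comm,
    ← integral_const_mul_of_integrable hGi, ← smul_neg, ← integral_neg]
  rw [heb, hea, ← smul_sub, ← integral_sub hib hia, ← hea]
  congr 1
  refine setIntegral_congr_fun measurableSet_Ioi fun t ht => ?_
  have ht : 0 < t := ht
  simp only [cfc_rpowIntegrand ha ht, cfc_rpowIntegrand hb ht, G]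
  have ha14 : a = a ^ (1 / 4 : ℝ≥0) * a ^ (3 / 4 : ℝ≥0) := by
    rw [← CFC.nnrpow_add (by norm_num) hq]
    have : (1 / 4 + 3 / 4 : ℝ≥0) = 1 := by norm_num
    rw [this, CFC.nnrpow_one a]
  -- The factor `a` in `a W b` commutes with the resolvent of `a` and splits as `a^{1/4} a^{3/4}`:
  -- the first part leaves the integral, the second stays in `L`.
  have hdiff : resolv a t - resolv b t = -(a ^ (1 / 4 : ℝ≥0) * (L t * T t)) := by
    rw [resolv_sub_resolv ha hb ht, ← neg_sub a b, hab, mul_neg, neg_mul]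
    congr 1
    calc resolv a t * (a * W * b) * resolv b t
        = resolv a t * a * (W * (b * resolv b t)) := by simp only [mul_assoc]
      _ = a * resolv a t * (W * (b * resolv b t)) := by rw [resolv_mul_self_comm ha]
      _ = a ^ (1 / 4 : ℝ≥0) * a ^ (3 / 4 : ℝ≥0) * resolv a t * (W * (b * resolv b t)) := by
          rw [← ha14]
      _ = _ := by simp only [L, T, mul_assoc]
  rw [← smul_sub, sub_sub_sub_cancel_left, hdiff, mul_smul_comm, smul_neg, hpr]

end PowerDifference


/-! ### From resolvents to the three operators -/

section AbstractPerturbation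

open scoped NNReal

variable {H : Type} [NormedAddCommGroup H] [InnerProductSpace ℂ H]

theorem mem_graph_ofBounded_iff (T : H →L[ℂ] H) (x y : H) :
    (x, y) ∈ (ofBounded T).graph ↔ T x = y := by
  rw [LinearPMap.mem_graph_iff]
  exact ⟨by rintro ⟨w, rfl, rfl⟩; rfl, fun h => ⟨⟨x, trivial⟩, rfl, h⟩⟩

theorem mem_graph_sub_iff (S T : H →ₗ.[ℂ] H) (x z : H) :
    (x, z) ∈ (S - T).graph ↔
      ∃ y₁ y₂, (x, y₁) ∈ S.graph ∧ (x, y₂) ∈ T.graph ∧ z = y₁ - y₂ := by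
  constructor
  · intro h
    obtain ⟨w, rfl, rfl⟩ := (LinearPMap.mem_graph_iff _).1 h
    exact ⟨_, _, S.mem_graph ⟨w, w.2.1⟩, T.mem_graph ⟨w, w.2.2⟩, LinearPMap.sub_apply S T w⟩
  · rintro ⟨y₁, y₂, h1, h2, rfl⟩
    obtain ⟨w, hw, rfl⟩ := (LinearPMap.mem_graph_iff _).1 h1
    obtain ⟨w', rfl, rfl⟩ := (LinearPMap.mem_graph_iff _).1 h2
    have hm : (w' : H) ∈ S.domain := by
      rw [← show (w : H) = w' from hw]; exact w.2
    have hw' : w = ⟨w', hm⟩ := Subtype.ext hw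
    rw [hw']
    exact (LinearPMap.mem_graph_iff _).2 ⟨⟨w', hm, w'.2⟩, rfl, LinearPMap.sub_apply S T _⟩

theorem mem_graph_add_iff (S T : H →ₗ.[ℂ] H) (x z : H) :
    (x, z) ∈ (S + T).graph ↔
      ∃ y₁ y₂, (x, y₁) ∈ S.graph ∧ (x, y₂) ∈ T.graph ∧ z = y₁ + y₂ := by
  constructor
  · intro h
    obtain ⟨w, rfl, rfl⟩ := (LinearPMap.mem_graph_iff _).1 h
    exact ⟨_, _, S.mem_graph ⟨w, w.2.1⟩, T.mem_graph ⟨w, w.2.2⟩, LinearPMap.add_apply S T w⟩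
  · rintro ⟨y₁, y₂, h1, h2, rfl⟩
    obtain ⟨w, hw, rfl⟩ := (LinearPMap.mem_graph_iff _).1 h1
    obtain ⟨w', rfl, rfl⟩ := (LinearPMap.mem_graph_iff _).1 h2
    have hm : (w' : H) ∈ S.domain := by
      rw [← show (w : H) = w' from hw]; exact w.2
    have hw' : w = ⟨w', hm⟩ := Subtype.ext hw
    rw [hw']
    exact (LinearPMap.mem_graph_iff _).2 ⟨⟨w', hm, w'.2⟩, rfl, LinearPMap.add_apply S T _⟩

theorem HasHilbertSchmidtExtension.of_graph {T : H →ₗ.[ℂ] H} {B : H →L[ℂ] H} {D : Set H}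
    (hD : Dense D) (hDT : ∀ x ∈ D, ∃ y, (x, y) ∈ T.graph) (hB : IsHilbertSchmidt B)
    (h : ∀ x y, (x, y) ∈ T.graph → y = B x) : HasHilbertSchmidtExtension T := by
  refine ⟨hD.mono fun x hx => ?_, B, fun x => h _ _ (T.mem_graph x), hB⟩
  obtain ⟨y, hy⟩ := hDT x hx
  exact LinearPMap.mem_domain_of_mem_graph hy

theorem IsBoundedInverse.injective {A : H →ₗ.[ℂ] H} {R : H →L[ℂ] H} (h : IsBoundedInverse A R) :
    Function.Injective R := by
  rw [injective_iff_map_eq_zero]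
  intro x hx
  exact LinearPMap.graph_fst_eq_zero_snd A ((h x 0).1 hx) rfl

variable [CompleteSpace H]

/-- The orthogonal complement of the range is the kernel of the adjoint. -/
theorem denseRange_of_isSelfAdjoint {T : H →L[ℂ] H} (hT : IsSelfAdjoint T)
    (hi : Function.Injective T) : DenseRange T := by
  have h : T.range.topologicalClosure = ⊤ := by
    rw [Submodule.topologicalClosure_eq_top_iff, ContinuousLinearMap.orthogonal_range,
      ← ContinuousLinearMap.star_eq_adjoint, hT.star_eq]
    exact LinearMap.ker_eq_bot.2 hi
  exact Submodule.dense_iff_topologicalClosure_eq_top.2 h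

/-- Allows the square root to be iterated: `ω` again has a nonnegative bounded inverse, hence
`ω^{±1/2}` obey the same rules. -/
theorem isBoundedInverse_posPow_half {A : H →ₗ.[ℂ] H} {R : H →L[ℂ] H} (h : IsBoundedInverse A R)
    (hR : 0 ≤ R) : IsBoundedInverse (posPow A (1 / 2)) (negPow A (1 / 2)) := fun x y =>
  (mem_graph_posPow_half_iff h hR y x).symm

theorem negPow_half_eq_sqrt {A : H →ₗ.[ℂ] H} {R : H →L[ℂ] H} (h : IsBoundedInverse A R) :
    negPow A (1 / 2) = CFC.sqrt R := by
  rw [negPow, boundedInverse_eq h]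
  exact (CFC.sqrt_eq_rpow (a := R)).symm

/-- The second resolvent identity transfers a Hilbert-Schmidt bound on `V a (t + a)⁻¹` to `b`. -/
theorem HSBound.mul_resolv {a b V : H →L[ℂ] H} (ha : 0 ≤ a) (hb : 0 ≤ b)
    (hab : a - b = a * V * b) {ι : Type} {e : HilbertBasis ι ℂ H} {c t : ℝ} (ht : 0 < t)
    (hc : 0 ≤ c) (h : HSBound e (V * (a * resolv a t)) c) :
    HSBound e (V * (b * resolv b t)) ((1 + ‖V‖ * ‖b‖) * c) := by
  -- The right-hand factor is bounded uniformly in `t`, because `‖t (t + b)⁻¹‖ ≤ 1`.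
  have hJ : b * resolv b t = a * resolv a t * (1 - V * (b * (t • resolv b t))) := by
    have h1 : b * resolv b t = a * resolv a t + t • (resolv a t - resolv b t) := by
      rw [mul_resolv_eq hb ht, mul_resolv_eq ha ht, smul_sub]; abel
    rw [h1, resolv_sub_resolv ha hb ht, ← neg_sub a b, hab, mul_sub, mul_one, sub_eq_add_neg]
    congr 1
    rw [← resolv_mul_self_comm ha]
    simp only [mul_neg, neg_mul, smul_neg, mul_smul_comm, mul_assoc]
  rw [hJ, ← mul_assoc V]
  refine (h.comp_right _).mono (by positivity) (mul_le_mul_of_nonneg_right ?_ hc)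
  refine (norm_sub_le _ _).trans (add_le_add ContinuousLinearMap.norm_id_le ?_)
  refine (norm_mul_le _ _).trans (mul_le_mul_of_nonneg_left ?_ (norm_nonneg _))
  refine (norm_mul_le _ _).trans (mul_le_of_le_one_right (norm_nonneg _) ?_)
  exact norm_smul_resolv_le hb ht

/-- The abstract form of the main result, for strictly positive self-adjoint operators `A₀` and
`A = A₀ + V` with bounded inverses `R₀` and `R`. -/
theorem hasHilbertSchmidtExtension_of_resolvent {A₀ A : H →ₗ.[ℂ] H} {R₀ R V : H →L[ℂ] H}
    (hA₀ : IsBoundedInverse A₀ R₀) (hA : IsBoundedInverse A R) (hR₀ : 0 ≤ R₀) (hR : 0 ≤ R)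
    (h1 : R₀ - R = R₀ * V * R) (h2 : R₀ - R = R * V * R₀)
    {ι : Type} (e : HilbertBasis ι ℂ H) {C : ℝ} (hC : 0 ≤ C)
    (hV : ∀ t : ℝ, 0 < t → HSBound e (V * (R₀ * resolv R₀ t)) (C * t ^ (-(7 / 8) : ℝ))) :
    ((prod (posPow (posPow A₀ (1 / 2)) (1 / 2)) (ofBounded (negPow (posPow A (1 / 2)) (1 / 2)))
        - ofBounded (ContinuousLinearMap.id ℂ H)).domain = ⊤ ∧
      HasHilbertSchmidtExtension
        (prod (posPow (posPow A₀ (1 / 2)) (1 / 2)) (ofBounded (negPow (posPow A (1 / 2)) (1 / 2)))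
          - ofBounded (ContinuousLinearMap.id ℂ H))) ∧
    HasHilbertSchmidtExtension
      (prod (ofBounded (negPow (posPow A₀ (1 / 2)) (1 / 2))) (posPow (posPow A (1 / 2)) (1 / 2))
        - ofBounded (ContinuousLinearMap.id ℂ H)) ∧
    HasHilbertSchmidtExtension
      (prod (ofBounded (negPow (posPow A₀ (1 / 2)) (1 / 2)))
        (prod (posPow A₀ (1 / 2) - posPow A (1 / 2))
          (ofBounded (negPow (posPow A₀ (1 / 2)) (1 / 2))))) := by
  have hw₀ := isBoundedInverse_posPow_half hA₀ hR₀
  have hw := isBoundedInverse_posPow_half hA hR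
  have hS₀nn : 0 ≤ negPow A₀ (1 / 2) := by
    rw [negPow_half_eq_sqrt hA₀]; exact CFC.sqrt_nonneg _
  have hSnn : 0 ≤ negPow A (1 / 2) := by
    rw [negPow_half_eq_sqrt hA]; exact CFC.sqrt_nonneg _
  have hg₀ := mem_graph_posPow_half_iff hw₀ hS₀nn
  have hg := mem_graph_posPow_half_iff hw hSnn
  have hK₀ : negPow (posPow A₀ (1 / 2)) (1 / 2) = R₀ ^ (1 / 4 : ℝ≥0) := by
    rw [negPow_half_eq_sqrt hw₀, negPow_half_eq_sqrt hA₀, CFC.sqrt_eq_nnrpow, CFC.nnrpow_sqrt]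
    congr 1
    rw [div_div]; norm_num
  have hK : negPow (posPow A (1 / 2)) (1 / 2) = R ^ (1 / 4 : ℝ≥0) := by
    rw [negPow_half_eq_sqrt hw, negPow_half_eq_sqrt hA, CFC.sqrt_eq_nnrpow, CFC.nnrpow_sqrt]
    congr 1
    rw [div_div]; norm_num
  have hKK₀ := negPow_half_mul_self hw₀ hS₀nn
  have hKK := negPow_half_mul_self hw hSnn
  have hSS₀ := negPow_half_mul_self hA₀ hR₀
  have hSS := negPow_half_mul_self hA hR
  set K₀ := negPow (posPow A₀ (1 / 2)) (1 / 2)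
  set K := negPow (posPow A (1 / 2)) (1 / 2)
  set S₀ := negPow A₀ (1 / 2)
  set S := negPow A (1 / 2)
  have hK₀s : IsSelfAdjoint K₀ := by rw [hK₀]; exact .of_nonneg CFC.nnrpow_nonneg
  have hKs : IsSelfAdjoint K := by rw [hK]; exact .of_nonneg CFC.nnrpow_nonneg
  have hK₀i : Function.Injective K₀ := by
    have := hw₀.injective
    rw [← hKK₀] at this
    exact Function.Injective.of_comp (f := K₀) (g := K₀) this
  have hKi : Function.Injective K := by
    have := hw.injective
    rw [← hKK] at this
    exact Function.Injective.of_comp (f := K) (g := K) this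
  obtain ⟨B₁, hB₁, hKB₁⟩ : ∃ B, IsHilbertSchmidt B ∧ K = K₀ + K₀ * B := by
    rw [hK, hK₀]
    refine exists_isHilbertSchmidt_nnrpow_eq hR₀ hR h1 e (C := (1 + ‖V‖ * ‖R‖) * C)
      (by positivity) fun t ht => ?_
    rw [mul_assoc]
    exact (hV t ht).mul_resolv hR₀ hR h1 ht (by positivity)
  -- With the roles exchanged the perturbation is `-V`, and the bound is needed for `R₀` itself, so
  -- no transfer is required.
  obtain ⟨B₂, hB₂, hKB₂⟩ : ∃ B, IsHilbertSchmidt B ∧ K₀ = K + K * B := by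
    rw [hK, hK₀]
    refine exists_isHilbertSchmidt_nnrpow_eq (W := -V) hR hR₀ ?_ e hC fun t ht => ?_
    · rw [← neg_sub, h2, mul_neg, neg_mul]
    · intro s
      simpa using hV t ht s
  have hKB₂' : K₀ = K + star B₂ * K := by
    have := congrArg star hKB₂
    rwa [star_add, star_mul, hKs.star_eq, hK₀s.star_eq] at this
  have e₁ : ∀ x, K x = K₀ (x + B₁ x) := fun x => by
    rw [map_add]; exact congrArg (fun T : H →L[ℂ] H => T x) hKB₁
  have e₂ : ∀ x, K₀ x = K (x + B₂ x) := fun x => by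
    rw [map_add]; exact congrArg (fun T : H →L[ℂ] H => T x) hKB₂
  have e₃ : ∀ x, K₀ x = K x + star B₂ (K x) := fun x =>
    congrArg (fun T : H →L[ℂ] H => T x) hKB₂'
  have f₀ : ∀ x, K₀ (K₀ x) = S₀ x := fun x => congrArg (fun T : H →L[ℂ] H => T x) hKK₀
  have f : ∀ x, K (K x) = S x := fun x => congrArg (fun T : H →L[ℂ] H => T x) hKK
  have g₀ : ∀ x, S₀ (S₀ x) = R₀ x := fun x => congrArg (fun T : H →L[ℂ] H => T x) hSS₀
  have g : ∀ x, S (S x) = R x := fun x => congrArg (fun T : H →L[ℂ] H => T x) hSS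
  have hop1 : ∀ x y, (x, y) ∈ (prod (posPow (posPow A₀ (1 / 2)) (1 / 2)) (ofBounded K)
      - ofBounded (ContinuousLinearMap.id ℂ H)).graph ↔ y = B₁ x := by
    intro x y
    simp only [mem_graph_sub_iff, mem_graph_prod_iff, mem_graph_ofBounded_iff, hg₀]
    constructor
    · rintro ⟨y₁, y₂, ⟨z, hz, hz'⟩, rfl, rfl⟩
      have := hK₀i (hz'.trans (hz.symm.trans (e₁ x)))
      rw [this]
      exact add_sub_cancel_left _ _
    · rintro rfl
      exact ⟨x + B₁ x, x, ⟨_, rfl, (e₁ x).symm⟩, rfl, (add_sub_cancel_left _ _).symm⟩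
  refine ⟨⟨?_, ?_⟩, ?_, ?_⟩
  · rw [eq_top_iff]
    intro x _
    exact LinearPMap.mem_domain_of_mem_graph ((hop1 x (B₁ x)).2 rfl)
  · exact .of_graph dense_univ (fun x _ => ⟨_, (hop1 x _).2 rfl⟩) hB₁ fun x y => (hop1 x y).1
  · refine .of_graph (denseRange_of_isSelfAdjoint hKs hKi) (B := star B₂) ?_ hB₂.star ?_
    · rintro _ ⟨y, rfl⟩
      refine ⟨K₀ y - K y, ?_⟩
      simp only [mem_graph_sub_iff, mem_graph_prod_iff, mem_graph_ofBounded_iff, hg]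
      exact ⟨_, _, ⟨y, rfl, rfl⟩, rfl, rfl⟩
    · intro x z
      simp only [mem_graph_sub_iff, mem_graph_prod_iff, mem_graph_ofBounded_iff, hg]
      rintro ⟨_, _, ⟨y, rfl, rfl⟩, rfl, rfl⟩
      rw [e₃]
      exact add_sub_cancel_left _ _
  -- If `x = K₀³ z`, then `ω₀^{-1/2} x = K₀⁴ z = R₀ z` lies in the domains of both `ω₀` and `ω`.
  · have hD : DenseRange (K₀ * K₀ * K₀) := by
      refine denseRange_of_isSelfAdjoint ?_ (hK₀i.comp (hK₀i.comp hK₀i))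
      rw [isSelfAdjoint_iff, star_mul, star_mul, hK₀s.star_eq, mul_assoc]
    refine .of_graph hD (B := -(B₂ + star B₂ + star B₂ * B₂)) ?_
      ((hB₂.add hB₂.star).add (hB₂.comp_left _)).neg ?_
    · rintro _ ⟨z, rfl⟩
      -- From `R₀ = S₀²` one gets `ω₀ R₀ z = S₀ z`; from `R₀ z = R (z + V R₀ z)` and `R = S²`, `ω R₀
      -- z = S (z + V R₀ z)`.
      refine ⟨K₀ (S₀ z - S (z + V (R₀ z))), ?_⟩
      simp only [mem_graph_sub_iff, mem_graph_prod_iff, mem_graph_ofBounded_iff, ← hw₀ _ _, ← hw _ _]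
      have hz : K₀ ((K₀ * K₀ * K₀) z) = R₀ z := by
        rw [← g₀, ← f₀, ← f₀]; rfl
      refine ⟨_, ⟨_, rfl, _, _, ?_, ?_, rfl⟩, rfl⟩
      · rw [g₀, hz]
      · rw [g, hz, map_add]
        have := congrArg (fun T : H →L[ℂ] H => T z) h2
        exact ((sub_eq_iff_eq_add'.1 this)).symm
    · intro x z
      simp only [mem_graph_sub_iff, mem_graph_prod_iff, mem_graph_ofBounded_iff, ← hw₀ _ _, ← hw _ _]
      rintro ⟨_, ⟨_, rfl, y₁, y₂, hy₁, hy₂, rfl⟩, rfl⟩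
      -- Here `y₁ = ω₀ K₀ x` and `y₂ = ω K₀ x`; cancelling one injective factor `K₀`, respectively
      -- `K`, leaves bounded operators only.
      have i₁ : K₀ y₁ = x := hK₀i (by rw [f₀, hy₁])
      have i₂ : K y₂ = x + B₂ x := hKi (by rw [f, hy₂, e₂])
      rw [map_sub, i₁, e₃ y₂, i₂, map_add]
      change _ = -(B₂ x + star B₂ x + star B₂ (B₂ x))
      abel

end AbstractPerturbation


/-! ### Multiplication operators and Fourier multipliers -/

section Multipliers

open FourierTransform
open scoped ENNReal ContDiff

/-- If the distributional Fourier transform of `f ∈ L²` is an `L¹` function `v`, then `f` is given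
by the inverse Fourier integral of `v`. -/
theorem ae_eq_fourierInv {f : L2} {v : Lp ℂ 1 (volume : Measure Space)}
    (h : 𝓕 (f : 𝓢'(Space, ℂ)) = (v : 𝓢'(Space, ℂ))) :
    f =ᵐ[volume] 𝓕⁻ (v : Space → ℂ) := by
  have hv : Integrable v := L1.integrable_coeFn v
  have hcont : Continuous (𝓕⁻ (v : Space → ℂ)) := by
    rw [Real.fourierInv_eq_fourier_comp_neg]
    exact VectorFourier.fourierIntegral_continuous Real.continuous_fourierChar
      (by exact continuous_inner) hv.comp_neg
  refine ae_eq_of_integral_contDiff_smul_eq ((Lp.memLp f).locallyIntegrable one_le_two)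
    hcont.locallyIntegrable fun g hg hgc => ?_
  have hg₁ : HasCompactSupport (Complex.ofRealCLM ∘ g) := hgc.comp_left rfl
  have hg₂ : ContDiff ℝ ∞ (Complex.ofRealCLM ∘ g) := by fun_prop
  let φ := hg₁.toSchwartzMap hg₂
  have h1 : (f : 𝓢'(Space, ℂ)) φ = ((v : 𝓢'(Space, ℂ))) (𝓕⁻ φ) := by
    rw [← fourierInv_apply, ← h, fourierInv_fourier_eq]
  rw [Lp.toTemperedDistribution_apply, Lp.toTemperedDistribution_apply] at h1
  -- Fubini moves the inverse transform from the test function to `v`; its kernel belongs to the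
  -- symmetric form `-⟨x, k⟩`.
  have h2 : ∫ x, 𝓕⁻ φ x • v x = ∫ x, φ x • 𝓕⁻ (v : Space → ℂ) x := by
    have := VectorFourier.integral_fourierIntegral_smul_eq_flip (L := -innerₗ Space)
      (μ := volume) (ν := volume) (f := φ) (g := v) Real.continuous_fourierChar
      (continuous_inner (𝕜 := ℝ) (E := Space)).neg φ.integrable hv
    have hflip : (-innerₗ Space).flip = -innerₗ Space := by
      ext x y; simp [real_inner_comm]
    rw [hflip] at this
    rw [SchwartzMap.fourierInv_coe]
    exact this
  exact h1.trans h2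

/-- A function in `H²(ℝ³)` is essentially bounded. -/
theorem MemH2.memLp_top {f : Space → ℂ} (hf : MemH2 f) : MemLp f ∞ (volume : Measure Space) := by
  obtain ⟨hf2, hs⟩ := hf
  -- Order `2` exceeds half the dimension, `3/2`.
  obtain ⟨v, hv⟩ := hs.fourier_memL1 (by simp; norm_num)
  have h1 := hf2.coeFn_toLp.symm.trans (ae_eq_fourierInv hv)
  refine memLp_top_of_bound hf2.1 (∫ x, ‖v x‖) ?_
  filter_upwards [h1] with x hx
  rw [hx]
  exact VectorFourier.norm_fourierIntegral_le_integral_norm _ _ _ _ _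

/-- Multiplication by an essentially bounded function. -/
def mulL (g : Space → ℂ) (hg : MemLp g ∞ (volume : Measure Space)) : L2 →L[ℂ] L2 :=
  (ContinuousLinearMap.lsmul ℂ ℂ).holderL volume ∞ 2 2 (hg.toLp g)

theorem mulL_eq_smul {g : Space → ℂ} (hg : MemLp g ∞ (volume : Measure Space)) (f : L2) :
    mulL g hg f = (hg.toLp g • f : L2) := rfl

theorem mulL_ae {g : Space → ℂ} (hg : MemLp g ∞ (volume : Measure Space)) (f : L2) :
    mulL g hg f =ᵐ[volume] fun x => g x * f x := by
  rw [mulL_eq_smul]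
  filter_upwards [Lp.coeFn_lpSMul (r := 2) (hg.toLp g) f, hg.coeFn_toLp] with x h1 h2
  rw [h1, Pi.smul_apply', h2, smul_eq_mul]

theorem mulL_mul {g h k : Space → ℂ} (hg : MemLp g ∞ (volume : Measure Space))
    (hh : MemLp h ∞ (volume : Measure Space)) (hk : MemLp k ∞ (volume : Measure Space))
    (hghk : ∀ x, g x * h x = k x) : mulL g hg * mulL h hh = mulL k hk := by
  ext f
  filter_upwards [mulL_ae hg (mulL h hh f), mulL_ae hh f, mulL_ae hk f] with x h1 h2 h3
  rw [mul_apply_eq_comp, h1, h2, h3, ← hghk, mul_assoc]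

theorem smul_one_add_mulL {g k : Space → ℂ} (hg : MemLp g ∞ (volume : Measure Space))
    (hk : MemLp k ∞ (volume : Measure Space)) (t : ℝ) (hgk : ∀ x, t + g x = k x) :
    t • (1 : L2 →L[ℂ] L2) + mulL g hg = mulL k hk := by
  ext f
  have e : (t • (1 : L2 →L[ℂ] L2) + mulL g hg) f = (t : ℂ) • f + mulL g hg f := by
    rw [add_apply, Complex.coe_smul]; rfl
  rw [e]
  filter_upwards [Lp.coeFn_add ((t : ℂ) • f) (mulL g hg f), Lp.coeFn_smul (t : ℂ) f,
    mulL_ae hg f, mulL_ae hk f] with x h1 h2 h3 h4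
  rw [h1, Pi.add_apply, h2, h3, h4, ← hgk, Pi.smul_apply, smul_eq_mul, add_mul]

theorem mulL_nonneg {g : Space → ℝ} (hg : MemLp (fun x => (g x : ℂ)) ∞ (volume : Measure Space))
    (h0 : ∀ᵐ x, 0 ≤ g x) : 0 ≤ mulL (fun x => (g x : ℂ)) hg := by
  rw [ContinuousLinearMap.nonneg_iff_isPositive, ContinuousLinearMap.isPositive_def]
  constructor
  · intro u v
    change inner ℂ (mulL _ hg u) v = inner ℂ u (mulL _ hg v)
    rw [L2.inner_def, L2.inner_def]
    refine integral_congr_ae ?_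
    filter_upwards [mulL_ae hg u, mulL_ae hg v] with x h1 h2
    rw [h1, h2]
    simp [RCLike.inner_apply]
    ring
  · intro u
    rw [ContinuousLinearMap.reApplyInnerSelf, L2.inner_def, ← integral_re (L2.integrable_inner _ _)]
    refine integral_nonneg_of_ae ?_
    filter_upwards [mulL_ae hg u, h0] with x h1 h2
    rw [h1]
    have : inner ℂ ((g x : ℂ) * u x) (u x) = ((g x * ‖u x‖ ^ 2 : ℝ) : ℂ) := by
      rw [← smul_eq_mul, inner_smul_left, inner_self_eq_norm_sq_to_K]
      simp
    rw [this]
    simp only [Pi.zero_apply, RCLike.re_to_complex, Complex.ofReal_re]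
    positivity

/-- The Fourier multiplier on `L²` with an essentially bounded symbol. -/
def fourierMul (g : Space → ℂ) (hg : MemLp g ∞ (volume : Measure Space)) : L2 →L[ℂ] L2 :=
  (Lp.fourierTransformₗᵢ Space ℂ).symm.toContinuousLinearEquiv.toContinuousLinearMap ∘L
    mulL g hg ∘L (Lp.fourierTransformₗᵢ Space ℂ).toContinuousLinearEquiv.toContinuousLinearMap

theorem fourierMul_apply {g : Space → ℂ} (hg : MemLp g ∞ (volume : Measure Space)) (f : L2) :
    fourierMul g hg f = 𝓕⁻ (mulL g hg (𝓕 f)) := rfl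

theorem fourierMul_mul {g h k : Space → ℂ} (hg : MemLp g ∞ (volume : Measure Space))
    (hh : MemLp h ∞ (volume : Measure Space)) (hk : MemLp k ∞ (volume : Measure Space))
    (hghk : ∀ x, g x * h x = k x) : fourierMul g hg * fourierMul h hh = fourierMul k hk := by
  refine ContinuousLinearMap.ext fun f => ?_
  rw [mul_apply_eq_comp, fourierMul_apply, fourierMul_apply, fourier_fourierInv_eq,
    fourierMul_apply, ← mulL_mul hg hh hk hghk]
  rfl

theorem smul_one_add_fourierMul {g k : Space → ℂ} (hg : MemLp g ∞ (volume : Measure Space))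
    (hk : MemLp k ∞ (volume : Measure Space)) (t : ℝ) (hgk : ∀ x, t + g x = k x) :
    t • (1 : L2 →L[ℂ] L2) + fourierMul g hg = fourierMul k hk := by
  refine ContinuousLinearMap.ext fun f => ?_
  rw [fourierMul_apply, ← smul_one_add_mulL hg hk t hgk]
  conv_lhs => rw [← FourierTransform.fourierInv_fourier_eq (E := L2) (F := L2) f]
  change (t • (𝓕⁻ (𝓕 f)) : L2) + 𝓕⁻ (mulL g hg (𝓕 (𝓕⁻ (𝓕 f)))) =
    𝓕⁻ ((t • 𝓕 f : L2) + mulL g hg (𝓕 f))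
  have ht : ∀ z : L2, t • z = (t : ℂ) • z := fun z => (Complex.coe_smul t z).symm
  rw [fourier_fourierInv_eq, FourierTransform.fourierInv_add, ht, ht,
    FourierTransform.fourierInv_smul]

theorem fourierMul_nonneg {g : Space → ℝ}
    (hg : MemLp (fun x => (g x : ℂ)) ∞ (volume : Measure Space))
    (h0 : ∀ᵐ x, 0 ≤ g x) : 0 ≤ fourierMul (fun x => (g x : ℂ)) hg := by
  have h := (ContinuousLinearMap.nonneg_iff_isPositive _).1 (mulL_nonneg hg h0)
  rw [ContinuousLinearMap.nonneg_iff_isPositive, ContinuousLinearMap.isPositive_def]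
  have key : ∀ u v : L2, inner ℂ (fourierMul _ hg u) v = inner ℂ (mulL _ hg (𝓕 u)) (𝓕 v) :=
    fun u v => by
      rw [fourierMul_apply, ← Lp.inner_fourier_eq, fourier_fourierInv_eq]
  constructor
  · intro u v
    change inner ℂ (fourierMul _ hg u) v = inner ℂ u (fourierMul _ hg v)
    rw [key, ← inner_conj_symm u, key, inner_conj_symm]
    exact h.1 _ _
  · intro u
    rw [ContinuousLinearMap.reApplyInnerSelf, key]
    exact h.2 (𝓕 u)

/-- A product `V(x) g(-i∇)` with `V, g ∈ L²` is Hilbert-Schmidt. -/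
theorem hsBound_mulL_fourierMul {V g : Space → ℂ} (hV : MemLp V ∞ (volume : Measure Space))
    (hg : MemLp g ∞ (volume : Measure Space)) (hV2 : MemLp V 2 (volume : Measure Space))
    (hg2 : MemLp g 2 (volume : Measure Space)) {ι : Type} (e : HilbertBasis ι ℂ L2) {c : ℝ}
    (hc : (∫ x, ‖V x‖ ^ 2) * (∫ k, ‖g k‖ ^ 2) ≤ c ^ 2) :
    HSBound e (mulL V hV * fourierMul g hg) c := fun s => by
  have hsq : ∀ f : L2, ‖f‖ ^ 2 = ∫ x, ‖f x‖ ^ 2 := fun f => by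
    rw [← inner_self_eq_norm_sq (𝕜 := ℂ) f, L2.inner_def, ← integral_re (L2.integrable_inner _ _)]
    refine integral_congr_ae (.of_forall fun x => ?_)
    exact inner_self_eq_norm_sq (𝕜 := ℂ) (f x)
  -- Chosen so that `g(-i∇) f (x) = ⟨w x, 𝓕 f⟩`, the inner product being conjugate-linear on the
  -- left; `‖w x‖ = ‖g‖₂` for every `x`.
  let w : Space → Space → ℂ := fun x k => (Real.fourierChar (-inner ℝ k x) : ℂ) * star (g k)
  have hwg : ∀ x k, ‖w x k‖ = ‖g k‖ := fun x k => by
    rw [norm_mul, Circle.norm_coe, one_mul, norm_star]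
  have hwm : ∀ x, MemLp (w x) 2 (volume : Measure Space) := fun x => by
    refine hg2.of_le ?_ (.of_forall fun k => ?_)
    · refine AEStronglyMeasurable.mul ?_ hg2.1.star
      refine Continuous.aestronglyMeasurable ?_
      exact continuous_subtype_val.comp (Real.continuous_fourierChar.comp (by fun_prop))
    · exact (hwg x k).le
  have hwn : ∀ x, ‖(hwm x).toLp‖ ^ 2 = ∫ k, ‖g k‖ ^ 2 := fun x => by
    rw [hsq]
    refine integral_congr_ae ?_
    filter_upwards [(hwm x).coeFn_toLp] with k hk
    rw [hk, hwg]
  have hval : ∀ f : L2, fourierMul g hg f =ᵐ[volume] fun x => inner ℂ (hwm x).toLp (𝓕 f) := by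
    intro f
    have hi : Integrable (mulL g hg (𝓕 f)) := by
      refine (memLp_one_iff_integrable.1 (hg2.mul (Lp.memLp (𝓕 f)) (r := 1))).congr ?_
      filter_upwards [mulL_ae hg (𝓕 f)] with x hx
      rw [hx, Pi.mul_apply, mul_comm]
    have h1 : 𝓕 ((fourierMul g hg f : L2) : 𝓢'(Space, ℂ)) =
        ((hi.toL1 _ : Lp ℂ 1 (volume : Measure Space)) : 𝓢'(Space, ℂ)) := by
      rw [Lp.fourier_toTemperedDistribution_eq, fourierMul_apply, fourier_fourierInv_eq]
      ext φ
      rw [Lp.toTemperedDistribution_apply, Lp.toTemperedDistribution_apply]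
      refine integral_congr_ae ?_
      filter_upwards [hi.coeFn_toL1] with x hx
      rw [hx]
    filter_upwards [ae_eq_fourierInv h1] with x hx
    rw [hx, Real.fourierInv_eq, L2.inner_def]
    refine integral_congr_ae ?_
    filter_upwards [hi.coeFn_toL1, mulL_ae hg (𝓕 f), (hwm x).coeFn_toLp] with k h1 h2 h3
    rw [h1, h2, h3, RCLike.inner_apply]
    simp [w, Circle.smul_def]
    ring
  have hn : ∀ f : L2, ‖(mulL V hV * fourierMul g hg) f‖ ^ 2 =
      ∫ x, ‖V x‖ ^ 2 * ‖inner ℂ (hwm x).toLp (𝓕 f)‖ ^ 2 := fun f => by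
    rw [hsq]
    refine integral_congr_ae ?_
    filter_upwards [mulL_ae hV (fourierMul g hg f), hval f] with x h1 h2
    rw [mul_apply_eq_comp, h1, h2, norm_mul, mul_pow]
  have hni : ∀ f : L2,
      Integrable fun x => ‖V x‖ ^ 2 * ‖inner ℂ (hwm x).toLp (𝓕 f)‖ ^ 2 := fun f => by
    refine ((Lp.memLp ((mulL V hV * fourierMul g hg) f)).integrable_norm_pow two_ne_zero).congr ?_
    filter_upwards [mulL_ae hV (fourierMul g hg f), hval f] with x h1 h2
    rw [mul_apply_eq_comp, h1, h2, norm_mul, mul_pow]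
  -- At each fixed `x`, Bessel for this family bounds the sum over `i` by `‖w x‖²`; integrating
  -- against `‖V x‖²` finishes.
  have horth : Orthonormal ℂ fun i => (𝓕 (e i) : L2) :=
    e.orthonormal.comp_linearIsometry (Lp.fourierTransformₗᵢ Space ℂ).toLinearIsometry
  refine le_trans ?_ hc
  simp only [hn]
  rw [← integral_finsetSum _ fun i _ => hni _, ← integral_mul_const]
  refine integral_mono (integrable_finsetSum _ fun i _ => hni _)
    ((hV2.integrable_norm_pow two_ne_zero).mul_const _) fun x => ?_
  simp only [← Finset.mul_sum]
  gcongr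
  rw [← hwn x]
  refine le_trans (le_of_eq ?_) (horth.sum_inner_products_le (s := s) (hwm x).toLp)
  exact Finset.sum_congr rfl fun i _ => by rw [norm_inner_symm]

end Multipliers


/-! ### Inverse of a nonnegatively perturbed operator -/

section BoundedPerturbation

variable {H : Type} [NormedAddCommGroup H] [InnerProductSpace ℂ H] [CompleteSpace H]

/-- A nonnegative bounded perturbation of a strictly positive operator has a nonnegative bounded
inverse. -/
theorem exists_isBoundedInverse_add {A₀ A : H →ₗ.[ℂ] H} {R₀ V : H →L[ℂ] H}
    (hA₀ : IsBoundedInverse A₀ R₀) (hR₀ : 0 ≤ R₀) (hV : 0 ≤ V)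
    (hA : ∀ y x, (y, x) ∈ A.graph ↔ (y, x - V y) ∈ A₀.graph) :
    ∃ R : H →L[ℂ] H, IsBoundedInverse A R ∧ 0 ≤ R ∧ R₀ - R = R₀ * V * R ∧
      R₀ - R = R * V * R₀ := by
  set S := CFC.sqrt R₀
  have hS : S * S = R₀ := CFC.sqrt_mul_sqrt_self R₀ hR₀
  have hSs : star S = S := (IsSelfAdjoint.of_nonneg (CFC.sqrt_nonneg R₀)).star_eq
  have hSVS : 0 ≤ S * V * S := by
    have := star_right_conjugate_nonneg hV S
    rwa [hSs] at this
  -- The inverse is taken as `S (1 + S V S)⁻¹ S` with `S = R₀^{1/2}`, a form in which nonnegativity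
  -- is visible.
  set P := resolv (S * V * S) 1
  have hP : 0 ≤ P := cfc_nonneg fun x hx => by
    have := spectrum_nonneg hSVS hx
    positivity
  have hP1 : P + S * V * S * P = 1 := by
    have := mul_resolv hSVS one_pos
    rwa [one_smul, add_mul, one_mul] at this
  have hP2 : P + P * (S * V * S) = 1 := by
    have := resolv_mul hSVS one_pos
    rwa [one_smul, mul_add, mul_one] at this
  have h1 : R₀ - S * P * S = R₀ * V * (S * P * S) := by
    rw [sub_eq_iff_eq_add', ← hS]
    calc S * S = S * (P + S * V * S * P) * S := by rw [hP1, mul_one]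
      _ = _ := by simp only [mul_add, add_mul, mul_assoc]
  have h2 : R₀ - S * P * S = S * P * S * V * R₀ := by
    rw [sub_eq_iff_eq_add', ← hS]
    calc S * S = S * (P + P * (S * V * S)) * S := by rw [hP2, mul_one]
      _ = _ := by simp only [mul_add, add_mul, mul_assoc]
  refine ⟨S * P * S, ?_, ?_, h1, h2⟩
  · intro x y
    set R := S * P * S
    have e1 : ∀ z, R₀ z - R z = R₀ (V (R z)) := fun z =>
      congrArg (fun T : H →L[ℂ] H => T z) h1
    have e2 : ∀ z, R₀ z - R z = R (V (R₀ z)) := fun z =>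
      congrArg (fun T : H →L[ℂ] H => T z) h2
    rw [hA, ← hA₀]
    constructor
    · rintro rfl
      rw [map_sub, ← e1, sub_sub_cancel]
    · intro h
      rw [map_sub] at h
      have e3 := e2 (x - V y)
      rw [map_sub R₀, h, map_sub R] at e3
      have e4 : R x = y + R (V y) - R (V y) := by
        rw [← sub_eq_zero]
        rw [← sub_eq_zero] at e3
        rw [← neg_eq_zero, ← e3]
        abel
      rw [e4, add_sub_cancel_right]
  · have := star_right_conjugate_nonneg hP S
    rwa [hSs] at this

end BoundedPerturbation

/-! ### The free resolvent and its Hilbert-Schmidt estimate -/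

section Free

open FourierTransform
open scoped ENNReal

/-- The symbol of `h₀ + m²`. -/
def omegaSq (m : ℝ) (k : Space) : ℝ := m ^ 2 + (2 * Real.pi) ^ 2 * ‖k‖ ^ 2

variable {m : ℝ}

theorem sq_le_omegaSq (m : ℝ) (k : Space) : m ^ 2 ≤ omegaSq m k :=
  le_add_of_nonneg_right (by positivity)

theorem omegaSq_pos (hm : 0 < m) (k : Space) : 0 < omegaSq m k :=
  (pow_pos hm 2).trans_le (sq_le_omegaSq m k)

theorem continuous_omegaSq (m : ℝ) : Continuous (omegaSq m) := by
  unfold omegaSq; fun_prop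

/-- Compares the symbol with the Sobolev weight; it gives both the `H²` range of the free resolvent
and the integrability of powers of the symbol. -/
theorem one_add_norm_sq_le_omegaSq (hm : 0 < m) (k : Space) :
    1 + ‖k‖ ^ 2 ≤ ((m ^ 2)⁻¹ + 1) * omegaSq m k := by
  have h1 : (m ^ 2)⁻¹ * m ^ 2 = 1 := inv_mul_cancel₀ (by positivity)
  have h2 : 1 ≤ (2 * Real.pi) ^ 2 := by nlinarith [Real.pi_gt_three]
  have h3 : ‖k‖ ^ 2 ≤ (2 * Real.pi) ^ 2 * ‖k‖ ^ 2 := le_mul_of_one_le_left (by positivity) h2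
  have h4 : 0 ≤ (m ^ 2)⁻¹ * ((2 * Real.pi) ^ 2 * ‖k‖ ^ 2) := by positivity
  unfold omegaSq
  nlinarith [sq_nonneg m]

theorem memLp_top_of_continuous_of_le {g : Space → ℝ} (hg : Continuous g) {C : ℝ}
    (h0 : ∀ k, 0 ≤ g k) (h : ∀ k, g k ≤ C) :
    MemLp (fun k => (g k : ℂ)) ∞ (volume : Measure Space) := by
  refine memLp_top_of_bound (Complex.continuous_ofReal.comp hg).aestronglyMeasurable C
    (.of_forall fun k => ?_)
  rw [Complex.norm_real, Real.norm_of_nonneg (h0 k)]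
  exact h k

theorem memLp_top_inv_omegaSq (hm : 0 < m) :
    MemLp (fun k => (((omegaSq m k)⁻¹ : ℝ) : ℂ)) ∞ (volume : Measure Space) := by
  refine memLp_top_of_continuous_of_le (C := (m ^ 2)⁻¹)
    ((continuous_omegaSq m).inv₀ fun k => (omegaSq_pos hm k).ne')
    (fun k => inv_nonneg.2 (omegaSq_pos hm k).le) fun k => ?_
  exact inv_anti₀ (by positivity) (sq_le_omegaSq m k)

/-- The resolvent `(h₀ + m²)⁻¹`. -/
def freeResolvent (hm : 0 < m) : L2 →L[ℂ] L2 :=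
  fourierMul (fun k => (((omegaSq m k)⁻¹ : ℝ) : ℂ)) (memLp_top_inv_omegaSq hm)

theorem freeResolvent_nonneg (hm : 0 < m) : 0 ≤ freeResolvent hm :=
  fourierMul_nonneg _ (.of_forall fun k => inv_nonneg.2 (omegaSq_pos hm k).le)

theorem hasTemperateGrowth_omegaSq (m : ℝ) :
    (fun k => (omegaSq m k : ℂ)).HasTemperateGrowth := by
  have : (omegaSq m).HasTemperateGrowth := by
    unfold omegaSq; fun_prop
  fun_prop

theorem hasTemperateGrowth_inv_omegaSq (hm : 0 < m) :
    (fun k => (((omegaSq m k)⁻¹ : ℝ) : ℂ)).HasTemperateGrowth := by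
  have h1 := Function.hasTemperateGrowth_one_add_norm_sq_rpow Space (-1)
  have h2 : (fun k : Space => (2 * Real.pi / m) • k).HasTemperateGrowth := by fun_prop
  have h3 := h1.comp h2
  have h4 : (fun k => (omegaSq m k)⁻¹).HasTemperateGrowth := by
    have h5 : (fun k => (omegaSq m k)⁻¹) = fun k : Space => (m ^ 2)⁻¹ *
        ((fun x : Space => (1 + ‖x‖ ^ 2) ^ (-1 : ℝ)) ∘ fun k => (2 * Real.pi / m) • k) k := by
      funext k
      rw [Function.comp_apply, Real.rpow_neg_one, ← mul_inv, omegaSq, norm_smul,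
        Real.norm_of_nonneg (by positivity)]
      field_simp
    rw [h5]
    fun_prop
  fun_prop

/-- Links the `L²` multiplier to the distributional one, so that inverting `-Δ + m²` becomes
cancellation of symbols. -/
theorem freeResolvent_toTemperedDistribution (hm : 0 < m) (x : L2) :
    ((freeResolvent hm x : L2) : 𝓢'(Space, ℂ)) =
      fourierMultiplierCLM ℂ (fun k => (((omegaSq m k)⁻¹ : ℝ) : ℂ)) (x : 𝓢'(Space, ℂ)) := by
  rw [freeResolvent, fourierMul_apply, ← Lp.fourierInv_toTemperedDistribution_eq, mulL_eq_smul,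
    Lp.toTemperedDistribution_smul_eq (hasTemperateGrowth_inv_omegaSq hm),
    ← Lp.fourier_toTemperedDistribution_eq, fourierMultiplierCLM_apply]

theorem neg_laplacian_add_eq (m : ℝ) (u : 𝓢'(Space, ℂ)) :
    -Δ u + ((m : ℂ) ^ 2) • u = fourierMultiplierCLM ℂ (fun k => (omegaSq m k : ℂ)) u := by
  have h1 : (fun k : Space => (omegaSq m k : ℂ)) =
      (fun _ => (m : ℂ) ^ 2) + ((2 * Real.pi : ℂ) ^ 2) • fun k : Space => Complex.ofReal (‖k‖ ^ 2) := by
    funext k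
    simp [omegaSq]
  have ht : (fun k : Space => Complex.ofReal (‖k‖ ^ 2)).HasTemperateGrowth := by fun_prop
  have ht' : (((2 * Real.pi : ℂ) ^ 2) •
      fun k : Space => Complex.ofReal (‖k‖ ^ 2)).HasTemperateGrowth := by
    change (fun k : Space => ((2 * Real.pi : ℂ) ^ 2) • Complex.ofReal (‖k‖ ^ 2)).HasTemperateGrowth
    fun_prop
  have h2 : fourierMultiplierCLM ℂ (fun k : Space => (omegaSq m k : ℂ)) u =
      fourierMultiplierCLM ℂ (fun _ : Space => (m : ℂ) ^ 2) u +
      fourierMultiplierCLM ℂ (((2 * Real.pi : ℂ) ^ 2) •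
        fun k : Space => Complex.ofReal (‖k‖ ^ 2)) u := by
    rw [h1, fourierMultiplierCLM_apply, smulLeftCLM_add (by fun_prop) ht', add_apply,
      FourierTransform.fourierInv_add]
    rfl
  rw [h2, fourierMultiplierCLM_const, fourierMultiplierCLM_smul ht, laplacian_eq_fourierMultiplierCLM,
    add_comm]
  congr 1
  rw [neg_smul, neg_neg, ← Complex.coe_smul]
  push_cast
  rfl

theorem mem_graph_freeOp_iff (y z : L2) :
    (y, z) ∈ freeOp.graph ↔ y ∈ H2 ∧ -Δ (y : 𝓢'(Space, ℂ)) = (z : 𝓢'(Space, ℂ)) := by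
  rw [LinearPMap.mem_graph_iff]
  constructor
  · rintro ⟨w, rfl, rfl⟩
    exact ⟨w.2, (exists_laplacian w).choose_spec⟩
  · rintro ⟨hy, hz⟩
    refine ⟨⟨y, hy⟩, rfl, toTemperedDistribution_injective ?_⟩
    exact (exists_laplacian ⟨y, hy⟩).choose_spec.symm.trans hz

/-- The Bessel potential of order `2` after the resolvent has the bounded symbol `(1 + |k|²) /
omegaSq m k`. -/
theorem freeResolvent_mem_H2 (hm : 0 < m) (x : L2) : freeResolvent hm x ∈ H2 := by
  change MemSobolev 2 2 ((freeResolvent hm x : L2) : 𝓢'(Space, ℂ))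
  have hx : MemSobolev 0 2 (x : 𝓢'(Space, ℂ)) := memSobolev_zero_iff.2 ⟨x, rfl⟩
  rw [← add_zero (2 : ℝ), ← memSobolev_besselPotential_iff, freeResolvent_toTemperedDistribution,
    besselPotential, fourierMultiplierCLM_fourierMultiplierCLM_apply
      (hasTemperateGrowth_inv_omegaSq hm) (by fun_prop)]
  refine hx.fourierMultiplierCLM_of_bounded
    ((hasTemperateGrowth_inv_omegaSq hm).mul (by fun_prop)) ⟨(m ^ 2)⁻¹ + 1, fun k => ?_⟩
  have hp := omegaSq_pos hm k
  rw [Pi.mul_apply, norm_mul, Complex.norm_real, Complex.norm_real,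
    Real.norm_of_nonneg (by positivity), Real.norm_of_nonneg (by positivity),
    show (2 / 2 : ℝ) = 1 by norm_num, Real.rpow_one, inv_mul_le_iff₀ hp, mul_comm]
  exact one_add_norm_sq_le_omegaSq hm k

theorem isBoundedInverse_freeResolvent (hm : 0 < m) :
    IsBoundedInverse (freeOp + ofBounded (((m : ℂ) ^ 2) • ContinuousLinearMap.id ℂ L2))
      (freeResolvent hm) := by
  intro x y
  have hω : ∀ k, omegaSq m k ≠ 0 := fun k => (omegaSq_pos hm k).ne'
  have hsmul : ∀ z : L2, ((((m : ℂ) ^ 2) • z : L2) : 𝓢'(Space, ℂ)) =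
      ((m : ℂ) ^ 2) • (z : 𝓢'(Space, ℂ)) := fun z =>
    map_smul (Lp.toTemperedDistributionCLM ℂ volume 2) _ z
  simp only [mem_graph_add_iff, mem_graph_ofBounded_iff, mem_graph_freeOp_iff]
  constructor
  · rintro rfl
    refine ⟨x - ((m : ℂ) ^ 2) • freeResolvent hm x, _, ⟨freeResolvent_mem_H2 hm x, ?_⟩, rfl,
      (sub_add_cancel _ _).symm⟩
    have hsub : ((x - ((m : ℂ) ^ 2) • freeResolvent hm x : L2) : 𝓢'(Space, ℂ)) =
        (x : 𝓢'(Space, ℂ)) - ((((m : ℂ) ^ 2) • freeResolvent hm x : L2) : 𝓢'(Space, ℂ)) :=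
      map_sub (Lp.toTemperedDistributionCLM ℂ volume 2) _ _
    rw [hsub, hsmul, eq_sub_iff_add_eq, neg_laplacian_add_eq, freeResolvent_toTemperedDistribution,
      fourierMultiplierCLM_fourierMultiplierCLM_apply (hasTemperateGrowth_inv_omegaSq hm)
        (hasTemperateGrowth_omegaSq m)]
    have : ((fun k => (((omegaSq m k)⁻¹ : ℝ) : ℂ)) * fun k => (omegaSq m k : ℂ)) =
        fun _ => (1 : ℂ) := by
      funext k
      rw [Pi.mul_apply, ← Complex.ofReal_mul, inv_mul_cancel₀ (hω k), Complex.ofReal_one]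
    rw [this, fourierMultiplierCLM_const, one_smul]
    rfl
  · rintro ⟨y₁, _, ⟨hy, hy₁⟩, rfl, rfl⟩
    apply toTemperedDistribution_injective
    have hadd : ((y₁ + ((m : ℂ) ^ 2) • y : L2) : 𝓢'(Space, ℂ)) =
        (y₁ : 𝓢'(Space, ℂ)) + ((((m : ℂ) ^ 2) • y : L2) : 𝓢'(Space, ℂ)) :=
      map_add (Lp.toTemperedDistributionCLM ℂ volume 2) _ _
    change ((freeResolvent hm (y₁ + ((m : ℂ) ^ 2) • y) : L2) : 𝓢'(Space, ℂ)) = y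
    rw [freeResolvent_toTemperedDistribution, hadd, hsmul, ← hy₁, neg_laplacian_add_eq,
      fourierMultiplierCLM_fourierMultiplierCLM_apply (hasTemperateGrowth_omegaSq m)
        (hasTemperateGrowth_inv_omegaSq hm)]
    have : ((fun k => (omegaSq m k : ℂ)) * fun k => (((omegaSq m k)⁻¹ : ℝ) : ℂ)) =
        fun _ => (1 : ℂ) := by
      funext k
      rw [Pi.mul_apply, ← Complex.ofReal_mul, mul_inv_cancel₀ (hω k), Complex.ofReal_one]
    rw [this, fourierMultiplierCLM_const, one_smul]
    rfl

/-- For bounded `V` the maximal domain is all of `L²`, so `h` has the domain of `h₀`. -/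
theorem mem_graph_mulOp_iff {V : Space → ℝ}
    (hV : MemLp (fun x => (V x : ℂ)) ∞ (volume : Measure Space)) (y z : L2) :
    (y, z) ∈ (mulOp V).graph ↔ mulL _ hV y = z := by
  have hm : ∀ y : L2, y ∈ (mulOp V).domain := fun y =>
    ((Lp.memLp (mulL _ hV y)).ae_eq (mulL_ae hV y) : MemLp _ 2 volume)
  have hval : ∀ w : (mulOp V).domain, mulOp V w = mulL _ hV w := fun w => by
    have h := MemLp.coeFn_toLp (show MemLp (fun x => (V x : ℂ) * (w : L2) x) 2 volume from w.2)
    exact Lp.ext (h.trans (mulL_ae hV w).symm)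
  rw [LinearPMap.mem_graph_iff]
  constructor
  · rintro ⟨w, rfl, rfl⟩
    exact (hval w).symm
  · rintro rfl
    exact ⟨⟨y, hm y⟩, rfl, hval _⟩

/-- The operator `(1 + t (h₀ + m²))⁻¹` is a Fourier multiplier. -/
theorem exists_freeResolvent_mul_resolv_eq (hm : 0 < m) {t : ℝ} (ht : 0 < t) :
    ∃ hg : MemLp (fun k => (((1 + t * omegaSq m k)⁻¹ : ℝ) : ℂ)) ∞ (volume : Measure Space),
      freeResolvent hm * resolv (freeResolvent hm) t = fourierMul _ hg := by
  have hpos : ∀ k, 0 < 1 + t * omegaSq m k := fun k => by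
    have := omegaSq_pos hm k
    positivity
  have hg : MemLp (fun k => (((1 + t * omegaSq m k)⁻¹ : ℝ) : ℂ)) ∞ (volume : Measure Space) := by
    refine memLp_top_of_continuous_of_le (C := 1)
      ((continuous_const.add (continuous_const.mul (continuous_omegaSq m))).inv₀
        fun k => (hpos k).ne') (fun k => (inv_pos.2 (hpos k)).le) fun k => ?_
    refine inv_le_one_of_one_le₀ (le_add_of_nonneg_right ?_)
    have := omegaSq_pos hm k
    positivity
  have hs : MemLp (fun k => ((t + (omegaSq m k)⁻¹ : ℝ) : ℂ)) ∞ (volume : Measure Space) := by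
    refine memLp_top_of_continuous_of_le (C := t + (m ^ 2)⁻¹)
      (continuous_const.add ((continuous_omegaSq m).inv₀ fun k => (omegaSq_pos hm k).ne'))
      (fun k => ?_) fun k => ?_
    · have := omegaSq_pos hm k
      positivity
    · gcongr
      exact sq_le_omegaSq m k
  refine ⟨hg, ?_⟩
  have hR := freeResolvent_nonneg hm
  have h1 : (t • (1 : L2 →L[ℂ] L2) + freeResolvent hm) * fourierMul _ hg = freeResolvent hm := by
    rw [freeResolvent, smul_one_add_fourierMul _ hs t fun k => (Complex.ofReal_add _ _).symm]
    refine fourierMul_mul _ _ _ fun k => ?_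
    rw [← Complex.ofReal_mul]
    congr 1
    have h2 := omegaSq_pos hm k
    have h3 := hpos k
    field_simp
    ring
  exact mul_resolv_eq_of_mul_eq hR ht h1

/-- The decay is `|k|^{-7/2}`, and `7/2 > 3`. -/
theorem integrable_omegaSq_rpow (hm : 0 < m) :
    Integrable (fun k => omegaSq m k ^ (-(7 / 4) : ℝ)) (volume : Measure Space) := by
  have h1 : Integrable (fun k : Space => (1 + ‖k‖ ^ 2) ^ (-(7 / 2) / 2 : ℝ)) volume :=
    integrable_rpow_neg_one_add_norm_sq (by simp; norm_num)
  have hD : 0 < (m ^ 2)⁻¹ + 1 := by positivity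
  refine (h1.const_mul (((m ^ 2)⁻¹ + 1) ^ (7 / 4 : ℝ))).mono' ?_ (.of_forall fun k => ?_)
  · exact ((continuous_omegaSq m).rpow_const fun k =>
      Or.inl (omegaSq_pos hm k).ne').aestronglyMeasurable
  · have hp := omegaSq_pos hm k
    rw [Real.norm_of_nonneg (by positivity)]
    have h2 : (((m ^ 2)⁻¹ + 1) * omegaSq m k) ^ (-(7 / 4) : ℝ) ≤
        (1 + ‖k‖ ^ 2) ^ (-(7 / 4) : ℝ) :=
      Real.rpow_le_rpow_of_nonpos (by positivity) (one_add_norm_sq_le_omegaSq hm k) (by norm_num)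
    rw [Real.mul_rpow hD.le hp.le, Real.rpow_neg hD.le, inv_mul_le_iff₀ (by positivity)] at h2
    rwa [show (-(7 / 2) / 2 : ℝ) = -(7 / 4) by norm_num]

theorem exists_hsBound_mulL_freeResolvent (hm : 0 < m) {V : Space → ℂ}
    (hV : MemLp V ∞ (volume : Measure Space)) (hV2 : MemLp V 2 (volume : Measure Space))
    {ι : Type} (e : HilbertBasis ι ℂ L2) :
    ∃ C : ℝ, 0 ≤ C ∧ ∀ t : ℝ, 0 < t →
      HSBound e (mulL V hV * (freeResolvent hm * resolv (freeResolvent hm) t))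
        (C * t ^ (-(7 / 8) : ℝ)) := by
  set I := ∫ k, omegaSq m k ^ (-(7 / 4) : ℝ)
  set N := ∫ x, ‖V x‖ ^ 2
  have hI : 0 ≤ I := integral_nonneg fun k => (Real.rpow_pos_of_pos (omegaSq_pos hm k) _).le
  have hN : 0 ≤ N := integral_nonneg fun x => by positivity
  refine ⟨Real.sqrt (N * I), Real.sqrt_nonneg _, fun t ht => ?_⟩
  obtain ⟨hg, heq⟩ := exists_freeResolvent_mul_resolv_eq hm ht
  have hsq : (t ^ (-(7 / 8) : ℝ)) ^ 2 = t ^ (-(7 / 4) : ℝ) := by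
    rw [← Real.rpow_natCast, ← Real.rpow_mul ht.le]; norm_num
  -- The exponent `-2` is weakened to `-7/4`, as the base is at least `1`; then the summand `1` is
  -- dropped. This trades decay in `k` for a singularity in `t` that is still integrable.
  have hle : ∀ k, ‖(((1 + t * omegaSq m k)⁻¹ : ℝ) : ℂ)‖ ^ 2 ≤
      t ^ (-(7 / 4) : ℝ) * omegaSq m k ^ (-(7 / 4) : ℝ) := fun k => by
    have hp := omegaSq_pos hm k
    have hq : 0 < 1 + t * omegaSq m k := by positivity
    rw [Complex.norm_real, Real.norm_of_nonneg (by positivity), ← Real.mul_rpow ht.le hp.le,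
      ← Real.rpow_neg_one, ← Real.rpow_natCast, ← Real.rpow_mul hq.le]
    calc (1 + t * omegaSq m k) ^ (-1 * ((2 : ℕ) : ℝ))
        ≤ (1 + t * omegaSq m k) ^ (-(7 / 4) : ℝ) :=
          Real.rpow_le_rpow_of_exponent_le (le_add_of_nonneg_right (by positivity)) (by norm_num)
      _ ≤ (t * omegaSq m k) ^ (-(7 / 4) : ℝ) :=
          Real.rpow_le_rpow_of_nonpos (by positivity) (le_add_of_nonneg_left zero_le_one)
            (by norm_num)
  have hint := (integrable_omegaSq_rpow hm).const_mul (t ^ (-(7 / 4) : ℝ))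
  have hgi : Integrable (fun k => ‖(((1 + t * omegaSq m k)⁻¹ : ℝ) : ℂ)‖ ^ 2) volume := by
    refine hint.mono' (hg.1.norm.pow 2) (.of_forall fun k => ?_)
    rw [Real.norm_of_nonneg (by positivity)]
    exact hle k
  rw [heq]
  refine hsBound_mulL_fourierMul hV hg hV2 ((memLp_two_iff_integrable_sq_norm hg.1).2 hgi) e ?_
  rw [mul_pow, Real.sq_sqrt (by positivity), hsq, mul_assoc]
  gcongr
  refine (integral_mono hgi hint hle).trans_eq ?_
  rw [integral_const_mul, mul_comm]

end Free

end HSLemma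

end

theorem mainTheorem6 (m : ℝ) (hm : 0 < m) (V : HSLemma.Space → ℝ)
    (hV0 : ∀ᵐ x, 0 ≤ V x) (hV : HSLemma.MemH2 (fun x => (V x : ℂ))) :
    ((HSLemma.op1 m V).domain = ⊤ ∧ HSLemma.HasHilbertSchmidtExtension (HSLemma.op1 m V)) ∧
      HSLemma.HasHilbertSchmidtExtension (HSLemma.op2 m V) ∧
      HSLemma.HasHilbertSchmidtExtension (HSLemma.op3 m V) := by
  have hVtop := HSLemma.MemH2.memLp_top hV
  have hV2 : MemLp (fun x => (V x : ℂ)) 2 (volume : Measure HSLemma.Space) := hV.1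
  have hA₀ := HSLemma.isBoundedInverse_freeResolvent hm
  obtain ⟨R, hA, hR, h1, h2⟩ := HSLemma.exists_isBoundedInverse_add
    (A := HSLemma.schrodingerOp V +
      HSLemma.ofBounded (((m : ℂ) ^ 2) • ContinuousLinearMap.id ℂ HSLemma.L2))
    (V := HSLemma.mulL _ hVtop)
    hA₀ (HSLemma.freeResolvent_nonneg hm) (HSLemma.mulL_nonneg hVtop hV0) fun y x => by
      -- Only a regrouping of `(h₀ + V) + m²` as `(h₀ + m²) + V`; no domain is lost since `V` is
      -- bounded.
      simp only [HSLemma.schrodingerOp, HSLemma.mem_graph_add_iff, HSLemma.mem_graph_mulOp_iff hVtop]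
      constructor
      · rintro ⟨_, u, ⟨v, _, hv, rfl, rfl⟩, hu, rfl⟩
        exact ⟨v, u, hv, hu, by abel⟩
      · rintro ⟨v, u, hv, hu, h⟩
        refine ⟨_, u, ⟨v, _, hv, rfl, rfl⟩, hu, ?_⟩
        rw [add_right_comm, ← h, sub_add_cancel]
  obtain ⟨w, e, -⟩ := exists_hilbertBasis ℂ HSLemma.L2
  obtain ⟨C, hC, hb⟩ := HSLemma.exists_hsBound_mulL_freeResolvent hm hVtop hV2 e
  exact HSLemma.hasHilbertSchmidtExtension_of_resolvent hA₀ hA (HSLemma.freeResolvent_nonneg hm) hR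
    h1 h2 e hC hb
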